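/- **Theorem.** Let $Y$ and $U$ be (real or complex) Hilbert spaces, let $A:D(A)\subset Y\to Y$ generate a $C_0$-semigroup $\{S(t)\}_{t\ge 0}$ on $Y$, and let $B\in\mathcal L(U;Y)$. Consider the control system $$y'(t)=Ay(t)+Bu(t),\qquad t>0. \tag{1}$$ For $T>0$ let $(H_Tf)(t):=f([t/T]\,T)$, where $[\cdot]$ denotes the integer part, and let $\mathcal F_{T,\infty}$ be the set of all $F:(0,\infty)\to\mathcal L(Y;U)$ such that $t\mapsto F(t)x$ is strongly measurable for every $x\in Y$, $\|F(\cdot)\|_{\mathcal L(Y;U)}$ is essentially bounded on every compact subset of $(0,\infty)$, and $F(t+T)=F(t)$ for a.e. $t>0$. System (1) is called *$\mathbf{(DP)}_T$-stabilizable* if there is an $F\in\mathcal F_{T,\infty}$ such that the closed-loop system $y'(t)=Ay(t)+BF(t)(H_Ty)(t)$, $t>0$, is exponentially stable, that is, there are constants $M,\omega>0$ such that for every $y_0\in Y$ there is a solution, and every solution satisfies $\|y(t)\|_Y\le Me^{-\omega t}\|y_0\|_Y$ for all $t\ge0$. Here a solution with initial state $y_0$ is a mild solution, i.e. a function $y\in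 C([0,\infty);Y)$ with $$y(t)=S(t)y_0+\int_0^tS(t-s)BF(s)(H_Ty)(s)\,ds\qquad\text{for all } t\ge 0.$$ Then the following statements are equivalent: (i) System (1) is $\mathbf{(DP)}_T$-stabilizable for all $T>0$. (ii) System (1) is $\mathbf{(DP)}_T$-stabilizable for some $T>0$. (iii) There are constants $T>0$, $\delta\in(0,1)$ and $C\ge 0$ such that $$\|S(T)^*\varphi\|_Y^2\le C\int_0^T\|B^*S(T-t)^*\varphi\|_U^2\,dt+\delta\|\varphi\|_Y^2\qquad\text{for all }\varphi\in Y.$$ -/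

import Mathlib

open MeasureTheory Set Filter Topology

/-- A `C₀`-semigroup `{S(t)}_{t ≥ 0}` of bounded linear operators on `Y`: `S(0) = I`,
`S(s + t) = S(s) S(t)` and all orbits `t ↦ S(t) x` are continuous on `[0, ∞)`.
The values `S t` for `t < 0` are irrelevant and never used. -/
structure C0Semigroup (𝕜 Y : Type*) [RCLike 𝕜] [NormedAddCommGroup Y]
    [InnerProductSpace 𝕜 Y] where
  /-- the operator `S(t)` -/
  op : ℝ → Y →L[𝕜] Y
  op_zero : op 0 = ContinuousLinearMap.id 𝕜 Y
  op_add : ∀ s t : ℝ, 0 ≤ s → 0 ≤ t → op (s + t) = (op s).comp (op t)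
  continuousOn_orbit : ∀ x : Y, ContinuousOn (fun t => op t x) (Ici 0)

/-- The (unbounded) operator `A : D(A) ⊂ Y → Y` is the generator of the semigroup `S`:
`x ∈ D(A)` with `A x = z` if and only if `(S(h) x - x) / h → z` as `h → 0⁺`. -/
def C0Semigroup.IsGeneratedBy {𝕜 Y : Type*} [RCLike 𝕜] [NormedAddCommGroup Y]
    [InnerProductSpace 𝕜 Y] (S : C0Semigroup 𝕜 Y) (A : Y →ₗ.[𝕜] Y) : Prop :=
  ∀ x z : Y, (x, z) ∈ A.graph ↔
    Tendsto (fun h : ℝ => ((h⁻¹ : ℝ) : 𝕜) • (S.op h x - x)) (𝓝[>] 0) (𝓝 z)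

/-- The `T`-periodic sample-and-hold observation `(H_T f)(t) = f([t/T] T)`. -/
noncomputable def sampleHold {Y : Type*} (T : ℝ) (f : ℝ → Y) (t : ℝ) : Y :=
  f ((⌊t / T⌋₊ : ℝ) * T)

/-- The class of `T`-periodic feedback laws in `L^∞_loc((0, ∞); 𝓛(Y; U))`. As usual for operator
valued functions, measurability is meant in the strong operator sense: `t ↦ F(t) x` is strongly
measurable for every `x`. -/
structure IsPeriodicFeedback {𝕜 Y U : Type*} [RCLike 𝕜] [NormedAddCommGroup Y]
    [InnerProductSpace 𝕜 Y] [NormedAddCommGroup U] [InnerProductSpace 𝕜 U]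
    (T : ℝ) (F : ℝ → Y →L[𝕜] U) : Prop where
  aestronglyMeasurable : ∀ x : Y, AEStronglyMeasurable (fun t => F t x) (volume.restrict (Ioi 0))
  locallyBounded : ∀ K : Set ℝ, IsCompact K → K ⊆ Ioi 0 →
    ∃ M : ℝ, ∀ᵐ t ∂(volume.restrict K), ‖F t‖ ≤ M
  periodic : ∀ᵐ t ∂(volume.restrict (Ioi (0 : ℝ))), F (t + T) = F t

/-- `y` is the (mild) solution on `[0, ∞)`, with initial state `y₀`, of the sampled closed-loop
system `y'(t) = A y(t) + B F(t) (H_T y)(t)`, where `A` generates `S`: `y ∈ C([0, ∞); Y)` and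
`y(t) = S(t) y₀ + ∫₀ᵗ S(t - s) B F(s) (H_T y)(s) ds` for `t ≥ 0`. -/
structure IsSampledSolution {𝕜 Y U : Type*} [RCLike 𝕜] [NormedAddCommGroup Y]
    [InnerProductSpace 𝕜 Y] [NormedSpace ℝ Y] [NormedAddCommGroup U] [InnerProductSpace 𝕜 U]
    (S : C0Semigroup 𝕜 Y) (B : U →L[𝕜] Y) (T : ℝ) (F : ℝ → Y →L[𝕜] U) (y₀ : Y)
    (y : ℝ → Y) : Prop where
  continuousOn : ContinuousOn y (Ici 0)
  duhamel : ∀ t : ℝ, 0 ≤ t →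
    y t = S.op t y₀ + ∫ s in (0 : ℝ)..t, S.op (t - s) (B (F s (sampleHold T y s)))

/-- Stabilizability with the `T`-periodic discrete observation mode and `T`-periodic feedback laws:
some periodic feedback law makes the sampled closed-loop system exponentially stable, i.e. every
initial state has a solution, and every solution satisfies `‖y(t)‖ ≤ M e^{-ω t} ‖y₀‖` with `M`,
`ω > 0` independent of the initial state. -/
def IsDPStabilizable {𝕜 Y U : Type*} [RCLike 𝕜] [NormedAddCommGroup Y]
    [InnerProductSpace 𝕜 Y] [NormedSpace ℝ Y] [NormedAddCommGroup U] [InnerProductSpace 𝕜 U]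
    (S : C0Semigroup 𝕜 Y) (B : U →L[𝕜] Y) (T : ℝ) : Prop :=
  ∃ F : ℝ → Y →L[𝕜] U, IsPeriodicFeedback T F ∧
    ∃ M ω : ℝ, 0 < M ∧ 0 < ω ∧ ∀ y₀ : Y,
      (∃ y : ℝ → Y, IsSampledSolution S B T F y₀ y) ∧
      ∀ y : ℝ → Y, IsSampledSolution S B T F y₀ y →
        ∀ t : ℝ, 0 ≤ t → ‖y t‖ ≤ M * Real.exp (-(ω * t)) * ‖y₀‖

/-- The weak observability inequality
`‖S(T)* φ‖² ≤ C ∫₀ᵀ ‖B* S(T - t)* φ‖² dt + δ ‖φ‖²` for all `φ ∈ Y`. -/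
def WeakObservabilityInequality {𝕜 Y U : Type*} [RCLike 𝕜] [NormedAddCommGroup Y]
    [InnerProductSpace 𝕜 Y] [CompleteSpace Y] [NormedAddCommGroup U] [InnerProductSpace 𝕜 U]
    [CompleteSpace U] (S : C0Semigroup 𝕜 Y) (B : U →L[𝕜] Y) (T C δ : ℝ) : Prop :=
  ∀ φ : Y, ‖(S.op T).adjoint φ‖ ^ 2 ≤
    C * (∫ t in (0 : ℝ)..T, ‖B.adjoint ((S.op (T - t)).adjoint φ)‖ ^ 2) + δ * ‖φ‖ ^ 2

/-! Necessity is duality. Pair the Duhamel formula at a large time τ with φ: the state is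
exponentially small and the control is bounded by a multiple of ‖y₀‖, so ‖S(τ)*φ‖ is at most a small
multiple of ‖φ‖ plus a multiple of ∫‖B*S(τ-s)*φ‖ ds (`exists_weakObservabilityInequality`).

For sufficiency, fix T and use on each period only controls B*S(T-t)*z, with z depending on the
sampled state. At the sampling instants the system becomes x⁺ = S(T)x + Gz, where G = ∫₀ᵀ
S(r)BB*S(r)* dr (`samplingFlow_period`). Iterating the inequality shrinks δ enough to transfer it to
some multiple NT (`exists_observability_multiple`), where it is a discrete inequality for S(T) and
G. A regularised inverse of the N-step Gramian gives linear controls contracting the state in N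
steps (`exists_contracting_control`). These look at the state only every N steps, so they are not
yet a T-periodic feedback; but they bound all finite-horizon quadratic costs (`exists_cost_bound`),
and the first-step optimal feedback K of a long horizon, used at every step, is then power stable
(`exists_stabilizing_feedback_of_bounded_cost`). The periodic law is F(t) = B*S(T-t)*K. -/

/-! ### Strongly continuous operator families and their integrals -/

section StronglyContinuousFamily

variable {𝕜 X Y Z : Type*} [RCLike 𝕜] [NormedAddCommGroup X] [NormedSpace 𝕜 X] [CompleteSpace X]
  [NormedAddCommGroup Y] [NormedSpace 𝕜 Y] [NormedAddCommGroup Z] [NormedSpace 𝕜 Z]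

/-- A strongly continuous family of bounded operators is uniformly bounded on compact intervals. -/
theorem exists_norm_le_of_continuous_orbits {K : ℝ → X →L[𝕜] Z}
    (hK : ∀ x, Continuous fun t => K t x) (a b : ℝ) :
    ∃ M : ℝ, 0 ≤ M ∧ ∀ t ∈ Icc a b, ‖K t‖ ≤ M := by
  obtain ⟨C, hC⟩ := banach_steinhaus (g := fun t : Icc a b => K t) (fun x => by
    obtain ⟨C, hC⟩ := (isCompact_Icc (a := a) (b := b)).exists_bound_of_continuousOn
      (hK x).continuousOn
    exact ⟨C, fun t => hC t t.2⟩)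
  exact ⟨max C 0, le_max_right _ _, fun t ht => (hC ⟨t, ht⟩).trans (le_max_left _ _)⟩

/-- A strongly continuous family of bounded operators is jointly continuous. -/
theorem continuous_uncurry_of_continuous_orbits {K : ℝ → X →L[𝕜] Z}
    (hK : ∀ x, Continuous fun t => K t x) : Continuous fun p : ℝ × X => K p.1 p.2 := by
  rw [continuous_iff_continuousAt]
  rintro ⟨t₀, x₀⟩
  obtain ⟨M, hM0, hM⟩ := exists_norm_le_of_continuous_orbits hK (t₀ - 1) (t₀ + 1)
  have h1 : Tendsto (fun p : ℝ × X => M * ‖p.2 - x₀‖ + ‖K p.1 x₀ - K t₀ x₀‖) (𝓝 (t₀, x₀))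
      (𝓝 0) := by
    have : Continuous fun p : ℝ × X => M * ‖p.2 - x₀‖ + ‖K p.1 x₀ - K t₀ x₀‖ := by
      have := (hK x₀).comp (continuous_fst (X := ℝ) (Y := X))
      simp only [Function.comp_def] at this
      fun_prop
    simpa using this.tendsto (t₀, x₀)
  rw [ContinuousAt, tendsto_iff_norm_sub_tendsto_zero]
  refine squeeze_zero' (Eventually.of_forall fun _ => norm_nonneg _) ?_ h1
  have hev : ∀ᶠ p : ℝ × X in 𝓝 (t₀, x₀), p.1 ∈ Icc (t₀ - 1) (t₀ + 1) :=
    (continuous_fst.tendsto (t₀, x₀)).eventually (Icc_mem_nhds (by simp) (by simp))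
  filter_upwards [hev] with p hp
  have : K p.1 p.2 - K t₀ x₀ = K p.1 (p.2 - x₀) + (K p.1 x₀ - K t₀ x₀) := by simp
  rw [this]
  refine (norm_add_le _ _).trans (add_le_add_left ?_ _)
  exact (K p.1).le_of_opNorm_le (hM _ hp) _

variable [NormedSpace ℝ Z] [SMulCommClass ℝ 𝕜 Z]

/-- The strong integral `x ↦ ∫ₐᵇ K(r) x dr` of a strongly continuous family of operators. -/
noncomputable def strongIntegral (K : ℝ → X →L[𝕜] Z) (hK : ∀ x, Continuous fun t => K t x)
    (a b : ℝ) : X →L[𝕜] Z :=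
  LinearMap.mkContinuousOfExistsBound
    { toFun := fun x => ∫ r in a..b, K r x
      map_add' := fun x y => by
        simp only [map_add]
        exact intervalIntegral.integral_add ((hK x).intervalIntegrable _ _)
          ((hK y).intervalIntegrable _ _)
      map_smul' := fun c x => by
        simp only [map_smul, RingHom.id_apply]
        exact intervalIntegral.integral_smul c _ } (by
    obtain ⟨M, -, hM⟩ := exists_norm_le_of_continuous_orbits hK (min a b) (max a b)
    refine ⟨M * |b - a|, fun x => ?_⟩
    have : ∀ r ∈ uIoc a b, ‖K r x‖ ≤ M * ‖x‖ := fun r hr =>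
      (K r).le_of_opNorm_le (hM r (Ioc_subset_Icc_self hr)) x
    calc ‖∫ r in a..b, K r x‖ ≤ M * ‖x‖ * |b - a| :=
          intervalIntegral.norm_integral_le_of_norm_le_const this
      _ = M * |b - a| * ‖x‖ := by ring)

theorem strongIntegral_apply (K : ℝ → X →L[𝕜] Z) (hK : ∀ x, Continuous fun t => K t x)
    (a b : ℝ) (x : X) : strongIntegral K hK a b x = ∫ r in a..b, K r x := rfl

end StronglyContinuousFamily

/-! ### Strong continuity of the adjoint semigroup -/

namespace C0Semigroup

variable {𝕜 Y : Type*} [RCLike 𝕜] [NormedAddCommGroup Y] [InnerProductSpace 𝕜 Y]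

/-- The semigroup, extended to negative times by the identity. -/
noncomputable def ext (S : C0Semigroup 𝕜 Y) (t : ℝ) : Y →L[𝕜] Y := S.op (max t 0)

theorem ext_of_nonneg (S : C0Semigroup 𝕜 Y) {t : ℝ} (ht : 0 ≤ t) : S.ext t = S.op t := by
  simp [ext, ht]

theorem ext_zero (S : C0Semigroup 𝕜 Y) : S.ext 0 = ContinuousLinearMap.id 𝕜 Y := by
  rw [S.ext_of_nonneg le_rfl, S.op_zero]

theorem ext_add (S : C0Semigroup 𝕜 Y) {s t : ℝ} (hs : 0 ≤ s) (ht : 0 ≤ t) :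
    S.ext (s + t) = (S.ext s).comp (S.ext t) := by
  rw [S.ext_of_nonneg hs, S.ext_of_nonneg ht, S.ext_of_nonneg (add_nonneg hs ht), S.op_add s t hs ht]

theorem ext_add_apply (S : C0Semigroup 𝕜 Y) {s t : ℝ} (hs : 0 ≤ s) (ht : 0 ≤ t) (x : Y) :
    S.ext (s + t) x = S.ext s (S.ext t x) := by
  rw [S.ext_add hs ht]; rfl

theorem continuous_ext (S : C0Semigroup 𝕜 Y) (x : Y) : Continuous fun t => S.ext t x :=
  (S.continuousOn_orbit x).comp_continuous (by fun_prop) fun _ => mem_Ici.2 (le_max_right _ _)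

section Adjoint

variable [CompleteSpace Y]

theorem adjoint_ext_add_apply (S : C0Semigroup 𝕜 Y) {s t : ℝ} (hs : 0 ≤ s) (ht : 0 ≤ t) (x : Y) :
    (S.ext (s + t)).adjoint x = (S.ext t).adjoint ((S.ext s).adjoint x) := by
  rw [S.ext_add hs ht, ContinuousLinearMap.adjoint_comp]; rfl

variable [NormedSpace ℝ Y] [IsScalarTower ℝ 𝕜 Y]

/-- The averaged adjoint orbit `t ↦ S(t)* J* φ`, `J = ∫₀ʰ S(r) dr`, is locally Lipschitz. -/
theorem continuousOn_adjoint_strongIntegral (S : C0Semigroup 𝕜 Y) {h : ℝ} (hh : 0 ≤ h) (φ : Y)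
    (R : ℝ) : ContinuousOn (fun t => (S.ext t).adjoint
      ((strongIntegral S.ext S.continuous_ext 0 h).adjoint φ)) (Icc 0 R) := by
  set J := strongIntegral S.ext S.continuous_ext 0 h
  obtain ⟨M, hM0, hM⟩ := exists_norm_le_of_continuous_orbits S.continuous_ext 0 (R + h)
  have hint : ∀ x a b, IntervalIntegrable (fun r => S.ext r x) volume a b :=
    fun x a b => (S.continuous_ext x).intervalIntegrable _ _
  -- J S(t) integrates over the window [t, t+h]. Two windows differ by pieces of length |t - s|, so
  -- J S(t) is Lipschitz in operator norm, and this survives taking adjoints.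
  have hJ : ∀ t, 0 ≤ t → ∀ x, J (S.ext t x) = ∫ r in t..t + h, S.ext r x := by
    intro t ht x
    have h1 : ∫ r in (0:ℝ)..h, S.ext (r + t) x = ∫ r in (0 + t)..(h + t), S.ext r x :=
      intervalIntegral.integral_comp_add_right (fun r => S.ext r x) t
    rw [zero_add, add_comm h] at h1
    rw [strongIntegral_apply, ← h1]
    refine intervalIntegral.integral_congr fun r hr => ?_
    rw [uIcc_of_le hh] at hr
    exact (S.ext_add_apply hr.1 ht x).symm
  have key : ∀ s ∈ Icc 0 R, ∀ t ∈ Icc 0 R, ∀ x,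
      ‖J (S.ext t x) - J (S.ext s x)‖ ≤ 2 * M * |t - s| * ‖x‖ := by
    intro s hs t ht x
    rw [hJ t ht.1, hJ s hs.1,
      intervalIntegral.integral_interval_sub_interval_comm (hint _ _ _) (hint _ _ _) (hint _ _ _)]
    have b1 : ‖∫ r in t..s, S.ext r x‖ ≤ M * ‖x‖ * |s - t| := by
      refine intervalIntegral.norm_integral_le_of_norm_le_const fun r hr => ?_
      refine (S.ext r).le_of_opNorm_le (hM r ⟨?_, ?_⟩) x
      · exact (le_min ht.1 hs.1).trans hr.1.le
      · exact hr.2.trans ((max_le ht.2 hs.2).trans (by linarith))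
    have b2 : ‖∫ r in (t + h)..(s + h), S.ext r x‖ ≤ M * ‖x‖ * |s + h - (t + h)| := by
      refine intervalIntegral.norm_integral_le_of_norm_le_const fun r hr => ?_
      refine (S.ext r).le_of_opNorm_le (hM r ⟨?_, ?_⟩) x
      · exact (le_min (add_nonneg ht.1 hh) (add_nonneg hs.1 hh)).trans hr.1.le
      · exact hr.2.trans (max_le (by linarith [ht.2]) (by linarith [hs.2]))
    rw [add_sub_add_right_eq_sub] at b2
    rw [abs_sub_comm t s]
    refine (norm_sub_le _ _).trans ?_
    linarith
  have hadj : ∀ t, (S.ext t).adjoint (J.adjoint φ) = (J.comp (S.ext t)).adjoint φ := by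
    intro t; rw [ContinuousLinearMap.adjoint_comp]; rfl
  have lip : LipschitzOnWith (Real.toNNReal (2 * M * ‖φ‖))
      (fun t => (S.ext t).adjoint (J.adjoint φ)) (Icc 0 R) := by
    refine LipschitzOnWith.of_dist_le_mul fun t ht s hs => ?_
    rw [Real.coe_toNNReal _ (by positivity), dist_eq_norm, hadj, hadj, Real.dist_eq,
      ← _root_.sub_apply, ← map_sub]
    have : ‖ContinuousLinearMap.adjoint (J.comp (S.ext t) - J.comp (S.ext s))‖
        ≤ 2 * M * |t - s| := by
      rw [LinearIsometryEquiv.norm_map]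
      exact ContinuousLinearMap.opNorm_le_bound _ (by positivity) (key s hs t ht)
    refine (ContinuousLinearMap.le_of_opNorm_le _ this φ).trans (le_of_eq (by ring))
  exact lip.continuousOn

/-- On a Hilbert space the adjoint of a `C₀`-semigroup has continuous orbits. -/
theorem continuous_adjoint_ext (S : C0Semigroup 𝕜 Y) (φ : Y) :
    Continuous fun t => (S.ext t).adjoint φ := by
  let V : Submodule 𝕜 Y :=
    { carrier := {φ | ∀ R, ContinuousOn (fun t => (S.ext t).adjoint φ) (Icc 0 R)}
      add_mem' := fun {a b} ha hb R => by
        simp only [map_add]; exact (ha R).add (hb R)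
      zero_mem' := fun R => by simpa using continuousOn_const
      smul_mem' := fun c x hx R => by
        simp only [map_smul]; exact (hx R).const_smul c }
  -- If ψ ⟂ V, testing against J_h*ψ ∈ V gives ⟨∫₀ʰ S(r)ψ dr, ψ⟩ = 0; dividing by h and letting h →
  -- 0⁺ gives ‖ψ‖² = 0.
  have hV : V.topologicalClosure = ⊤ := by
    rw [Submodule.topologicalClosure_eq_top_iff, Submodule.eq_bot_iff]
    intro ψ hψ
    have h0 : ∀ h : ℝ, 0 ≤ h → inner 𝕜 (∫ r in (0:ℝ)..h, S.ext r ψ) ψ = 0 := by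
      intro h hh
      have hm : (strongIntegral S.ext S.continuous_ext 0 h).adjoint ψ ∈ V :=
        S.continuousOn_adjoint_strongIntegral hh ψ
      have := hψ _ hm
      rw [ContinuousLinearMap.adjoint_inner_left, strongIntegral_apply] at this
      rw [← inner_conj_symm, this, map_zero]
    have hd : HasDerivAt (fun h : ℝ => ∫ r in (0:ℝ)..h, S.ext r ψ) (S.ext 0 ψ) 0 :=
      intervalIntegral.integral_hasDerivAt_right ((S.continuous_ext ψ).intervalIntegrable _ _)
        (S.continuous_ext ψ).stronglyMeasurable.stronglyMeasurableAtFilter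
        (S.continuous_ext ψ).continuousAt
    have ht := (hasDerivAt_iff_tendsto_slope_zero.1 hd).mono_left
      (nhdsWithin_mono 0 (fun x (hx : x ∈ Ioi (0:ℝ)) => ne_of_gt hx))
    have ht2 := ht.inner (𝕜 := 𝕜) (tendsto_const_nhds (x := ψ))
    have : (fun t : ℝ => inner 𝕜 (t⁻¹ • ((∫ r in (0:ℝ)..(0 + t), S.ext r ψ) -
        ∫ r in (0:ℝ)..0, S.ext r ψ)) ψ) =ᶠ[𝓝[>] 0] fun _ => (0 : 𝕜) := by
      filter_upwards [self_mem_nhdsWithin] with t ht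
      rw [zero_add, intervalIntegral.integral_same, sub_zero,
        ← algebraMap_smul 𝕜 (t⁻¹ : ℝ), inner_smul_left, h0 t (le_of_lt ht), mul_zero]
    have := tendsto_nhds_unique (ht2.congr' this) tendsto_const_nhds
    rw [S.ext_zero, ContinuousLinearMap.id_apply, inner_self_eq_zero] at this
    exact this
  have hR : ∀ R, ContinuousOn (fun t => (S.ext t).adjoint φ) (Icc 0 R) := by
    intro R
    obtain ⟨M, hM0, hM⟩ := exists_norm_le_of_continuous_orbits S.continuous_ext 0 R
    have hφ : φ ∈ closure (V : Set Y) := by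
      rw [← Submodule.topologicalClosure_coe, hV]; trivial
    refine continuousOn_of_uniform_approx_of_continuousOn fun u hu => ?_
    obtain ⟨ε, hε, hu⟩ := Metric.mem_uniformity_dist.1 hu
    obtain ⟨ψ, hψ, hd⟩ := Metric.mem_closure_iff.1 hφ (ε / (M + 1)) (by positivity)
    refine ⟨_, hψ R, fun t ht => hu ?_⟩
    rw [dist_eq_norm, ← map_sub]
    rw [dist_eq_norm, lt_div_iff₀ (by positivity)] at hd
    have : ‖(S.ext t).adjoint‖ ≤ M := by rw [LinearIsometryEquiv.norm_map]; exact hM t ht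
    have := (S.ext t).adjoint.le_of_opNorm_le this (φ - ψ)
    nlinarith [norm_nonneg (φ - ψ)]
  have hIci : ContinuousOn (fun t => (S.ext t).adjoint φ) (Ici 0) := by
    intro t ht
    refine ((hR (t + 1)) t ⟨ht, by linarith⟩).mono_of_mem_nhdsWithin ?_
    rw [mem_nhdsWithin]
    exact ⟨Iio (t + 1), isOpen_Iio, by simp, fun x hx => ⟨hx.2, (le_of_lt hx.1)⟩⟩
  have := hIci.comp_continuous (f := fun t : ℝ => max t 0) (by fun_prop)
    fun _ => mem_Ici.2 (le_max_right _ _)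
  simpa [ext, Function.comp_def] using this

end Adjoint

end C0Semigroup

/-! ### Discrete-time linear quadratic control -/

section DiscreteLQ

open ContinuousLinearMap RCLike

variable {𝕜 Y : Type*} [RCLike 𝕜] [NormedAddCommGroup Y] [InnerProductSpace 𝕜 Y] [CompleteSpace Y]

/-- The quadratic form is coercive with constant ε. -/
theorem ContinuousLinearMap.IsPositive.isUnit_add_smul_one {T : Y →L[𝕜] Y} (hT : T.IsPositive)
    {ε : ℝ} (hε : 0 < ε) : IsUnit (T + (ε : 𝕜) • (1 : Y →L[𝕜] Y)) := by
  refine isUnit_of_forall_le_norm_inner_map _ (c := ⟨ε, hε.le⟩) hε fun x => ?_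
  refine le_trans ?_ (re_le_norm _)
  have h1 : re (inner 𝕜 ((T + (ε : 𝕜) • (1 : Y →L[𝕜] Y)) x) x)
      = re (inner 𝕜 (T x) x) + ε * ‖x‖ ^ 2 := by
    simp only [add_apply, smul_apply, one_def, id_apply, inner_add_left, inner_smul_left, conj_ofReal,
      map_add, re_ofReal_mul, inner_self_eq_norm_sq]
  have := hT.re_inner_nonneg_left x
  rw [h1]
  change ‖x‖ ^ 2 * ε ≤ _
  linarith

/-- One step of dynamic programming: the quadratic cost `‖z‖² + ⟨P (A x + G z), A x + G z⟩` is
minimised by a bounded linear feedback `z = L x`. -/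
theorem exists_minimizing_feedback (A G : Y →L[𝕜] Y) {P : Y →L[𝕜] Y} (hP : P.IsPositive) :
    ∃ L : Y →L[𝕜] Y, ∀ x z, ‖L x‖ ^ 2 + P.reApplyInnerSelf (A x + G (L x)) ≤
      ‖z‖ ^ 2 + P.reApplyInnerSelf (A x + G z) := by
  -- With R = (G*PG + 1)⁻¹, L = -R G*PA solves the stationarity equation z + G*P(Ax + Gz) = 0. A
  -- deviation d from the minimiser then costs exactly ‖d‖² + ⟨PGd, Gd⟩ ≥ 0.
  obtain ⟨R, hR⟩ := ((hP.adjoint_conj G).isUnit_add_smul_one (ε := 1) one_pos).exists_right_inv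
  refine ⟨-(R * (adjoint G * P * A)), fun x z => ?_⟩
  set l := (-(R * (adjoint G * P * A))) x with hl
  have hstat : l + adjoint G (P (A x + G l)) = 0 := by
    have := congrArg (fun f : Y →L[𝕜] Y => f (adjoint G (P (A x)))) hR
    have hl' : l = -(R (adjoint G (P (A x)))) := rfl
    have hm : R (adjoint G (P (A x))) = -l := by rw [hl', neg_neg]
    simp only [ofReal_one, one_smul, mul_def, one_def, id_apply, comp_apply, add_apply, hm,
      map_neg] at this
    rw [map_add, map_add, ← this]
    abel
  obtain ⟨d, rfl⟩ : ∃ d, z = l + d := ⟨z - l, by abel⟩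
  set w := A x + G l with hw
  have e1 : A x + G (l + d) = w + G d := by rw [map_add, hw]; abel
  have e2 : re (inner 𝕜 (P (G d)) w) = re (inner 𝕜 (P w) (G d)) := by
    rw [hP.inner_left_eq_inner_right, ← inner_re_symm]
  have e3 : re (inner 𝕜 (P w) (G d)) = - re (inner 𝕜 l d) := by
    rw [← adjoint_inner_left, eq_neg_of_add_eq_zero_right hstat, inner_neg_left, map_neg]
  have e4 : P.reApplyInnerSelf (w + G d) = P.reApplyInnerSelf w - 2 * re (inner 𝕜 l d) +
      P.reApplyInnerSelf (G d) := by
    simp only [reApplyInnerSelf_apply, map_add, inner_add_left, inner_add_right, e2, e3]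
    ring
  have := hP.2 (G d)
  rw [e1, e4, norm_add_sq (𝕜 := 𝕜)]
  nlinarith [sq_nonneg ‖d‖]

/-- The finite horizon value functions of the linear quadratic problem `x⁺ = A x + G z` with
running cost `‖x‖² + ‖z‖²`, together with the optimal feedbacks. -/
theorem exists_riccati_sequence (A G : Y →L[𝕜] Y) :
    ∃ P L : ℕ → Y →L[𝕜] Y, P 0 = 0 ∧ (∀ n, (P n).IsPositive) ∧
      (∀ n x, (P (n + 1)).reApplyInnerSelf x =
        ‖x‖ ^ 2 + ‖L n x‖ ^ 2 + (P n).reApplyInnerSelf (A x + G (L n x))) ∧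
      ∀ n x z, (P (n + 1)).reApplyInnerSelf x ≤
        ‖x‖ ^ 2 + ‖z‖ ^ 2 + (P n).reApplyInnerSelf (A x + G z) := by
  choose! f hf using fun (P : Y →L[𝕜] Y) (hP : P.IsPositive) => exists_minimizing_feedback A G hP
  -- The Riccati map in closed-loop form, which makes positivity and the cost identity immediate.
  let step : (Y →L[𝕜] Y) → (Y →L[𝕜] Y) := fun P =>
    1 + (adjoint (f P)).comp (f P) + (adjoint (A + G * f P)).comp (P.comp (A + G * f P))
  let P : ℕ → Y →L[𝕜] Y := fun n => step^[n] 0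
  have hstep : ∀ n, P (n + 1) = step (P n) := fun n => Function.iterate_succ_apply' _ _ _
  have hpos : ∀ n, (P n).IsPositive := by
    intro n
    induction n with
    | zero => exact isPositive_zero
    | succ n ih =>
      rw [hstep]
      exact (isPositive_one.add (isPositive_adjoint_comp_self _)).add (ih.adjoint_conj _)
  have heq : ∀ n x, (P (n + 1)).reApplyInnerSelf x =
      ‖x‖ ^ 2 + ‖f (P n) x‖ ^ 2 + (P n).reApplyInnerSelf (A x + G (f (P n) x)) := by
    intro n x
    rw [hstep]
    simp only [step, reApplyInnerSelf_apply, add_apply, one_def, id_apply, mul_def, comp_apply, inner_add_left,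
      adjoint_inner_left, map_add, inner_self_eq_norm_sq, inner_add_right]
    ring
  refine ⟨P, fun n => f (P n), rfl, hpos, heq, fun n x z => ?_⟩
  rw [heq]
  linarith [hf (P n) (hpos n) x z]

omit [CompleteSpace Y] in
/-- If finite horizon costs are uniformly bounded, the optimal feedback for a long horizon
stabilizes the system. -/
theorem exists_stabilizing_feedback_of_bounded_cost (A G : Y →L[𝕜] Y) {P L : ℕ → Y →L[𝕜] Y}
    (hpos : ∀ n, (P n).IsPositive)
    (heq : ∀ n x, (P (n + 1)).reApplyInnerSelf x =
        ‖x‖ ^ 2 + ‖L n x‖ ^ 2 + (P n).reApplyInnerSelf (A x + G (L n x)))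
    (hle : ∀ n x z, (P (n + 1)).reApplyInnerSelf x ≤
        ‖x‖ ^ 2 + ‖z‖ ^ 2 + (P n).reApplyInnerSelf (A x + G z))
    {c : ℝ} (hc : 1 ≤ c) (hbd : ∀ n x, (P n).reApplyInnerSelf x ≤ c * ‖x‖ ^ 2) :
    ∃ (K : Y →L[𝕜] Y) (σ : ℝ), 0 < σ ∧ σ < 1 ∧
      ∀ k x, ‖((A + G * K) ^ k) x‖ ^ 2 ≤ c * σ ^ k * ‖x‖ ^ 2 := by
  have hc0 : 0 < c := by linarith
  set ρ := 1 - c⁻¹ with hρ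
  have hinv : c⁻¹ ≤ 1 := inv_le_one_of_one_le₀ hc
  have hinv0 : 0 < c⁻¹ := by positivity
  have hρ0 : 0 ≤ ρ := by linarith
  have hlow : ∀ n x, ‖x‖ ^ 2 ≤ (P (n + 1)).reApplyInnerSelf x := fun n x => by
    have := (hpos n).2 (A x + G (L n x))
    rw [heq]; nlinarith [sq_nonneg ‖L n x‖]
  -- The running cost is at least ‖x‖² ≥ c⁻¹ P_{n+1}(x), so an optimal step lowers the remaining
  -- cost by the factor ρ = 1 - c⁻¹.
  have hdec : ∀ n x, (P n).reApplyInnerSelf (A x + G (L n x)) ≤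
      ρ * (P (n + 1)).reApplyInnerSelf x := by
    intro n x
    have h1 : c⁻¹ * (P (n + 1)).reApplyInnerSelf x ≤ ‖x‖ ^ 2 := by
      rw [inv_mul_le_iff₀ hc0]; exact hbd _ _
    have h2 := heq n x
    rw [hρ, sub_mul, one_mul]
    nlinarith [sq_nonneg ‖L n x‖]
  -- Using the optimal control of the shorter horizon as a competitor for the longer one bounds the
  -- gap at x by the previous gap at the next state; `hdec` contributes one factor ρ each time.
  have hdiff : ∀ n x, (P (n + 2)).reApplyInnerSelf x - (P (n + 1)).reApplyInnerSelf x ≤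
      c * ρ ^ n * (P (n + 1)).reApplyInnerSelf x := by
    intro n
    induction n with
    | zero =>
      intro x
      have h1 := hbd 2 x
      have h2 := hlow 0 x
      have h3 := (hpos 1).2 x
      simp only [zero_add, pow_zero, mul_one] at *
      nlinarith
    | succ n ih =>
      intro x
      have h1 := hle (n + 2) x (L (n + 1) x)
      have h2 := heq (n + 1) x
      have h3 := ih (A x + G (L (n + 1) x))
      have h4 := mul_le_mul_of_nonneg_left (hdec (n + 1) x) (show 0 ≤ c * ρ ^ n by positivity)
      rw [pow_succ]
      calc _ ≤ c * ρ ^ n * (ρ * (P (n + 1 + 1)).reApplyInnerSelf x) := by linarith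
        _ = _ := by ring
  obtain ⟨n, hn⟩ : ∃ n, c * c * ρ ^ n ≤ 1 / 2 := by
    obtain ⟨n, hn⟩ := exists_pow_lt_of_lt_one (show 0 < 1 / 2 / (c * c) by positivity)
      (show ρ < 1 by linarith)
    refine ⟨n, ?_⟩
    rw [lt_div_iff₀ (by positivity)] at hn
    linarith
  have hhalf : ∀ x, (P (n + 2)).reApplyInnerSelf x - (P (n + 1)).reApplyInnerSelf x ≤
      1 / 2 * ‖x‖ ^ 2 := by
    intro x
    have h1 := hdiff n x
    have h2 := mul_le_mul_of_nonneg_left (hbd (n + 1) x) (show 0 ≤ c * ρ ^ n by positivity)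
    have h3 := mul_le_mul_of_nonneg_right hn (sq_nonneg ‖x‖)
    linarith
  -- P_{n+1} is a Lyapunov function for L_{n+1}: a step gains ‖x‖² from P_{n+2}, replacing P_{n+2}
  -- by P_{n+1} loses at most half of it, and ‖x‖²/2 ≥ (c⁻¹/2) P_{n+1}(x).
  set σ := 1 - c⁻¹ / 2 with hσ
  have hσ0 : 0 < σ := by linarith
  refine ⟨L (n + 1), σ, hσ0, by linarith, ?_⟩
  have hcontr : ∀ x, (P (n + 1)).reApplyInnerSelf ((A + G * L (n + 1)) x) ≤
      σ * (P (n + 1)).reApplyInnerSelf x := by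
    intro x
    have h1 := heq (n + 1) x
    have h2 := hhalf x
    have h3 : c⁻¹ * (P (n + 1)).reApplyInnerSelf x ≤ ‖x‖ ^ 2 := by
      rw [inv_mul_le_iff₀ hc0]; exact hbd _ _
    have h4 : (A + G * L (n + 1)) x = A x + G (L (n + 1) x) := rfl
    rw [h4, hσ, sub_mul, one_mul]
    nlinarith [sq_nonneg ‖L (n + 1) x‖]
  have hiter : ∀ k x, (P (n + 1)).reApplyInnerSelf (((A + G * L (n + 1)) ^ k) x) ≤
      σ ^ k * (P (n + 1)).reApplyInnerSelf x := by
    intro k x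
    induction k with
    | zero => simp
    | succ k ih =>
      rw [pow_succ', mul_def, comp_apply]
      refine (hcontr _).trans ?_
      rw [pow_succ', mul_assoc]
      exact mul_le_mul_of_nonneg_left ih hσ0.le
  intro k x
  have h1 := mul_le_mul_of_nonneg_left (hbd (n + 1) x) (show 0 ≤ σ ^ k by positivity)
  calc _ ≤ _ := hlow n _
    _ ≤ _ := hiter k x
    _ ≤ σ ^ k * (c * ‖x‖ ^ 2) := h1
    _ = _ := by ring

omit [CompleteSpace Y] in
/-- If over `N` steps the state can be contracted by linear controls `z_k = Z_k x`, then the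
finite horizon costs are uniformly bounded. -/
theorem exists_cost_bound (A G : Y →L[𝕜] Y) {P L : ℕ → Y →L[𝕜] Y} (h0 : P 0 = 0)
    (hpos : ∀ n, (P n).IsPositive)
    (heq : ∀ n x, (P (n + 1)).reApplyInnerSelf x =
        ‖x‖ ^ 2 + ‖L n x‖ ^ 2 + (P n).reApplyInnerSelf (A x + G (L n x)))
    (hle : ∀ n x z, (P (n + 1)).reApplyInnerSelf x ≤
        ‖x‖ ^ 2 + ‖z‖ ^ 2 + (P n).reApplyInnerSelf (A x + G z))
    {X Z : ℕ → Y →L[𝕜] Y} (hX0 : X 0 = 1) (hX : ∀ k, X (k + 1) = A * X k + G * Z k)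
    {N : ℕ} (hN : 0 < N) {θ : ℝ} (hθ : θ < 1) (hXN : ∀ x, ‖X N x‖ ^ 2 ≤ θ * ‖x‖ ^ 2) :
    ∃ c : ℝ, 1 ≤ c ∧ ∀ n x, (P n).reApplyInnerSelf x ≤ c * ‖x‖ ^ 2 := by
  set b := ∑ k ∈ Finset.range N, (‖X k‖ ^ 2 + ‖Z k‖ ^ 2) with hb
  have hb0 : 0 ≤ b := by positivity
  have hθ' : 0 < 1 - θ := by linarith
  have hblock : ∀ j n x, (P (n + j)).reApplyInnerSelf x ≤
      (∑ k ∈ Finset.range j, (‖X k x‖ ^ 2 + ‖Z k x‖ ^ 2)) + (P n).reApplyInnerSelf (X j x) := by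
    intro j
    induction j with
    | zero => intro n x; simp [hX0]
    | succ j ih =>
      intro n x
      have h1 := ih (n + 1) x
      have h2 := hle n (X j x) (Z j x)
      have h3 : X (j + 1) x = A (X j x) + G (Z j x) := by rw [hX]; rfl
      rw [Finset.sum_range_succ, h3, show n + (j + 1) = n + 1 + j by ring]
      linarith
  have hsum : ∀ x, ∑ k ∈ Finset.range N, (‖X k x‖ ^ 2 + ‖Z k x‖ ^ 2) ≤ b * ‖x‖ ^ 2 := by
    intro x
    rw [hb, Finset.sum_mul]
    refine Finset.sum_le_sum fun k _ => ?_
    rw [add_mul, ← mul_pow, ← mul_pow]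
    gcongr <;> exact le_opNorm _ _
  -- Chosen so that b + θc ≤ c: the bound for horizon jN then reproduces itself for (j+1)N. Other
  -- horizons follow by monotonicity.
  set c := max 1 (b / (1 - θ)) with hc
  have hc1 : 1 ≤ c := le_max_left _ _
  have hcb : b ≤ (1 - θ) * c := by
    have : b / (1 - θ) ≤ c := le_max_right _ _
    rwa [div_le_iff₀ hθ', mul_comm] at this
  have hmono : ∀ x, Monotone fun n => (P n).reApplyInnerSelf x := by
    have : ∀ n x, (P n).reApplyInnerSelf x ≤ (P (n + 1)).reApplyInnerSelf x := by
      intro n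
      induction n with
      | zero =>
        intro x
        rw [h0]
        simpa [reApplyInnerSelf_apply] using (hpos 1).2 x
      | succ n ih =>
        intro x
        rw [heq (n + 1)]
        exact (hle n x (L (n + 1) x)).trans (add_le_add_right (ih _) _)
    exact fun x => monotone_nat_of_le_succ fun n => this n x
  have hmul : ∀ j x, (P (j * N)).reApplyInnerSelf x ≤ c * ‖x‖ ^ 2 := by
    intro j
    induction j with
    | zero =>
      intro x
      simp only [zero_mul, h0, reApplyInnerSelf_apply, zero_apply, inner_zero_left, map_zero]
      positivity
    | succ j ih =>
      intro x
      rw [Nat.succ_mul]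
      have h1 := hblock N (j * N) x
      have h2 := ih (X N x)
      have h3 := mul_le_mul_of_nonneg_left (hXN x) (show 0 ≤ c by linarith)
      have h4 := mul_le_mul_of_nonneg_right hcb (sq_nonneg ‖x‖)
      have h5 := hsum x
      nlinarith
  exact ⟨c, hc1, fun n x => (hmono x (Nat.le_mul_of_pos_right n hN)).trans (hmul n x)⟩

/-- If the Gramian `W` dominates `E E*` up to `δ < 1`, then `E x + W z` can be made a strict
contraction by a linear control `z = R E x`. -/
theorem exists_contracting_control {W E : Y →L[𝕜] Y} (hW : W.IsPositive) {C δ : ℝ} (hC : 0 ≤ C)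
    (hδ0 : 0 < δ) (hδ : δ < 1)
    (hobs : ∀ φ, ‖adjoint E φ‖ ^ 2 ≤ C * W.reApplyInnerSelf φ + δ * ‖φ‖ ^ 2) :
    ∃ (R : Y →L[𝕜] Y) (θ : ℝ), θ < 1 ∧ ∀ x, ‖E x - W (R (E x))‖ ^ 2 ≤ θ * ‖x‖ ^ 2 := by
  -- Small enough that θ = Cε + δ < 1; R below is (W + ε)⁻¹.
  set ε := (1 - δ) / (2 * (C + 1)) with hε
  have hε0 : 0 < ε := div_pos (by linarith) (by positivity)
  have hCε : C * ε + δ < 1 := by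
    have : (C + 1) * ε = (1 - δ) / 2 := by rw [hε]; field_simp
    nlinarith
  obtain ⟨R, hR⟩ := (hW.isUnit_add_smul_one hε0).exists_right_inv
  have hR' : ∀ y, W (R y) + (ε : 𝕜) • R y = y := fun y =>
    congrArg (fun f : Y →L[𝕜] Y => f y) hR
  refine ⟨R, C * ε + δ, hCε, fun x => ?_⟩
  set y := R (E x)
  have hw : E x - W y = (ε : 𝕜) • y := by
    rw [sub_eq_iff_eq_add', hR']
  rw [hw]
  set w := (ε : 𝕜) • y with hwdef
  -- Solving once more with the residual w as datum gives ‖w‖² = re⟨Ex, v⟩ = re⟨x, E*v⟩, while the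
  -- energy identity for v gives ‖v‖ ≤ ‖w‖ and ⟨Wv, v⟩ ≤ ε‖w‖². Observability at v closes the
  -- estimate.
  set v := (ε : 𝕜) • R w with hv
  have hWv : W v + (ε : 𝕜) • v = (ε : 𝕜) • w := by
    rw [hv, map_smul, ← smul_add, hR']
  have hWy : W y + w = E x := hR' _
  have hsym : re (inner 𝕜 w w) = re (inner 𝕜 (E x) v) := by
    have h1 : inner 𝕜 (W y + w) v = inner 𝕜 w w := by
      have h2 : W v = (ε : 𝕜) • w - (ε : 𝕜) • v := eq_sub_of_add_eq hWv
      rw [inner_add_left, hW.inner_left_eq_inner_right, h2, inner_sub_right, inner_smul_right,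
        inner_smul_right]
      rw [hwdef]
      simp only [inner_smul_left, inner_smul_right, conj_ofReal]
      ring
    rw [← hWy, h1]
  have hEre : re (inner 𝕜 (W v) v) + ε * ‖v‖ ^ 2 = ε * re (inner 𝕜 w v) := by
    have := congrArg (fun u => re (inner 𝕜 u v)) hWv
    simpa only [inner_add_left, inner_smul_left, conj_ofReal, map_add, re_ofReal_mul,
      inner_self_eq_norm_sq] using this
  have hwv : re (inner 𝕜 w v) ≤ ‖w‖ * ‖v‖ := (re_le_norm _).trans (norm_inner_le_norm _ _)
  have hWv0 : 0 ≤ re (inner 𝕜 (W v) v) := hW.2 v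
  have hvw : ‖v‖ ≤ ‖w‖ := by
    by_contra! h
    have : ‖v‖ ^ 2 ≤ ‖w‖ * ‖v‖ := by
      have : ε * ‖v‖ ^ 2 ≤ ε * (‖w‖ * ‖v‖) := by nlinarith
      exact le_of_mul_le_mul_left this hε0
    nlinarith [norm_nonneg w]
  have hWvw : W.reApplyInnerSelf v ≤ ε * ‖w‖ ^ 2 := by
    rw [reApplyInnerSelf_apply]
    have : ‖w‖ * ‖v‖ ≤ ‖w‖ ^ 2 := by nlinarith [norm_nonneg w]
    have : ε * re (inner 𝕜 w v) ≤ ε * ‖w‖ ^ 2 :=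
      mul_le_mul_of_nonneg_left (hwv.trans this) hε0.le
    nlinarith [sq_nonneg ‖v‖]
  have hEv : ‖adjoint E v‖ ^ 2 ≤ (C * ε + δ) * ‖w‖ ^ 2 := by
    have h1 := hobs v
    have h2 := mul_le_mul_of_nonneg_left hWvw hC
    have h3 : δ * ‖v‖ ^ 2 ≤ δ * ‖w‖ ^ 2 := by gcongr
    linarith
  have hfin : ‖w‖ ^ 2 ≤ ‖x‖ * ‖adjoint E v‖ := by
    rw [← inner_self_eq_norm_sq (𝕜 := 𝕜), hsym, ← adjoint_inner_right]
    exact (re_le_norm _).trans (norm_inner_le_norm _ _)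
  by_cases hw0 : ‖w‖ = 0
  · rw [hw0, zero_pow two_ne_zero]; positivity
  · have hwp : 0 < ‖w‖ ^ 2 := by positivity
    have : (‖w‖ ^ 2) ^ 2 ≤ (‖x‖ * ‖adjoint E v‖) ^ 2 := by gcongr
    rw [mul_pow] at this
    have : ‖w‖ ^ 2 * ‖w‖ ^ 2 ≤ ‖w‖ ^ 2 * ((C * ε + δ) * ‖x‖ ^ 2) := by
      nlinarith [sq_nonneg ‖x‖]
    exact le_of_mul_le_mul_left this hwp

/-- A discrete weak observability inequality implies stabilizability of `x⁺ = A x + G z` by a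
stationary feedback. -/
theorem exists_stabilizing_feedback (A G : Y →L[𝕜] Y) (hG : G.IsPositive) {N : ℕ} (hN : 0 < N)
    {C δ : ℝ} (hC : 0 ≤ C) (hδ0 : 0 < δ) (hδ : δ < 1)
    (hobs : ∀ φ, ‖(adjoint A ^ N) φ‖ ^ 2 ≤
      C * (∑ k ∈ Finset.range N, G.reApplyInnerSelf ((adjoint A ^ k) φ)) + δ * ‖φ‖ ^ 2) :
    ∃ (K : Y →L[𝕜] Y) (c σ : ℝ), 0 ≤ c ∧ 0 < σ ∧ σ < 1 ∧
      ∀ k x, ‖((A + G * K) ^ k) x‖ ^ 2 ≤ c * σ ^ k * ‖x‖ ^ 2 := by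
  have hadj : ∀ k, adjoint (A ^ k) = adjoint A ^ k := fun k => star_pow A k
  set W : Y →L[𝕜] Y := ∑ k ∈ Finset.range N, A ^ k * G * adjoint A ^ k with hWdef
  have hWapp : ∀ φ, W.reApplyInnerSelf φ =
      ∑ k ∈ Finset.range N, G.reApplyInnerSelf ((adjoint A ^ k) φ) := by
    intro φ
    simp only [reApplyInnerSelf_apply, hWdef, _root_.sum_apply, sum_inner, map_sum, ← hadj,
      mul_def, comp_apply, adjoint_inner_right]
  have hW : W.IsPositive := by
    refine Finset.sum_induction _ _ (fun _ _ => IsPositive.add) isPositive_zero fun k _ => ?_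
    rw [← hadj]
    exact hG.conj_adjoint (A ^ k)
  obtain ⟨R, θ, hθ, hR⟩ := exists_contracting_control (E := A ^ N) hW hC hδ0 hδ fun φ => by
    rw [hadj, hWapp]; exact hobs φ
  -- The powers of A* run backwards in time, so that the accumulated input at step N is -W R A^N.
  let Z : ℕ → Y →L[𝕜] Y := fun k => -(adjoint A ^ (N - 1 - k) * R * A ^ N)
  let X : ℕ → Y →L[𝕜] Y := fun k => Nat.rec 1 (fun k x => A * x + G * Z k) k
  have hX : ∀ k, X (k + 1) = A * X k + G * Z k := fun _ => rfl
  have hXj : ∀ j, X j = A ^ j + ∑ k ∈ Finset.range j, A ^ (j - 1 - k) * G * Z k := by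
    intro j
    induction j with
    | zero => simp [X]
    | succ j ih =>
      rw [hX, ih, Finset.sum_range_succ, mul_add, ← pow_succ', Finset.mul_sum, add_assoc]
      congr 2
      · refine Finset.sum_congr rfl fun k hk => ?_
        have : j + 1 - 1 - k = (j - 1 - k) + 1 := by have := Finset.mem_range.1 hk; omega
        rw [this, pow_succ', mul_assoc, mul_assoc, mul_assoc]
      · simp
  have hXN : X N = A ^ N - W * R * A ^ N := by
    rw [hXj, sub_eq_add_neg, ← Finset.sum_range_reflect, hWdef, Finset.sum_mul, Finset.sum_mul,
      ← Finset.sum_neg_distrib]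
    congr 1
    refine Finset.sum_congr rfl fun k hk => ?_
    have : N - 1 - (N - 1 - k) = k := by have := Finset.mem_range.1 hk; omega
    simp only [Z, mul_neg, mul_assoc, this]
  obtain ⟨P, L, h0, hpos, heq, hle⟩ := exists_riccati_sequence A G
  obtain ⟨c, hc, hbd⟩ := exists_cost_bound A G h0 hpos heq hle (X := X) (Z := Z) rfl hX hN hθ
    fun x => by rw [hXN]; exact hR x
  obtain ⟨K, σ, hσ0, hσ1, hK⟩ :=
    exists_stabilizing_feedback_of_bounded_cost A G hpos heq hle hc hbd
  exact ⟨K, c, σ, by linarith, hσ0, hσ1, hK⟩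

end DiscreteLQ

/-! ### Stabilizability implies weak observability -/

section Necessity

/-- Expand ∫(w - m/τ)² ≥ 0, with m/τ the mean of w. -/
theorem sq_intervalIntegral_le {w : ℝ → ℝ} (hw : Continuous w) {τ : ℝ} (hτ : 0 < τ) :
    (∫ s in (0:ℝ)..τ, w s) ^ 2 ≤ τ * ∫ s in (0:ℝ)..τ, w s ^ 2 := by
  set m := ∫ s in (0:ℝ)..τ, w s with hm
  have h0 : 0 ≤ ∫ s in (0:ℝ)..τ, (w s - m / τ) ^ 2 :=
    intervalIntegral.integral_nonneg hτ.le fun _ _ => sq_nonneg _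
  have h1 : ∫ s in (0:ℝ)..τ, (w s - m / τ) ^ 2 =
      (∫ s in (0:ℝ)..τ, w s ^ 2) - 2 * (m / τ) * m + τ * (m / τ) ^ 2 := by
    have : ∀ s, (w s - m / τ) ^ 2 = w s ^ 2 - 2 * (m / τ) * w s + (m / τ) ^ 2 := fun s => by ring
    simp only [this]
    rw [intervalIntegral.integral_add, intervalIntegral.integral_sub,
      intervalIntegral.integral_const_mul, ← hm, intervalIntegral.integral_const]
    · simp
    all_goals exact Continuous.intervalIntegrable (by fun_prop) _ _
  rw [h1] at h0
  have h2 : (∫ s in (0:ℝ)..τ, w s ^ 2) - 2 * (m / τ) * m + τ * (m / τ) ^ 2 =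
      (∫ s in (0:ℝ)..τ, w s ^ 2) - m ^ 2 / τ := by field_simp; ring
  rw [h2, sub_nonneg, div_le_iff₀ hτ] at h0
  linarith

variable {𝕜 Y U : Type*} [RCLike 𝕜]
  [NormedAddCommGroup Y] [InnerProductSpace 𝕜 Y] [CompleteSpace Y]
  [NormedSpace ℝ Y] [IsScalarTower ℝ 𝕜 Y]
  [NormedAddCommGroup U] [InnerProductSpace 𝕜 U] [CompleteSpace U]

omit [IsScalarTower ℝ 𝕜 Y] in
-- Integrability of f is not needed: otherwise its integral is 0 by convention. This covers the
-- Duhamel integrand of an arbitrary feedback.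
theorem norm_inner_intervalIntegral_le {f : ℝ → Y} {g : ℝ → ℝ} {τ : ℝ} (hτ : 0 ≤ τ) (φ : Y)
    (hg : IntervalIntegrable g volume 0 τ) (hg0 : ∀ s, 0 ≤ g s)
    (h : ∀ᵐ s, s ∈ Ioc 0 τ → ‖inner 𝕜 φ (f s)‖ ≤ g s) :
    ‖inner 𝕜 φ (∫ s in (0:ℝ)..τ, f s)‖ ≤ ∫ s in (0:ℝ)..τ, g s := by
  by_cases hf : IntervalIntegrable f volume 0 τ
  · have := (innerSL 𝕜 φ).intervalIntegral_comp_comm hf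
    simp only [innerSL_apply_apply] at this
    rw [← this]
    exact intervalIntegral.norm_integral_le_of_norm_le hτ h hg
  · rw [intervalIntegral.integral_undef hf, inner_zero_right, norm_zero]
    exact intervalIntegral.integral_nonneg hτ fun s _ => hg0 s

omit [CompleteSpace Y] [NormedSpace ℝ Y] [IsScalarTower ℝ 𝕜 Y] [CompleteSpace U] in
-- Local boundedness says nothing near t = 0; periodicity imports the bound from [T, τ+T].
theorem IsPeriodicFeedback.exists_ae_bound {T : ℝ} (hT : 0 < T) {F : ℝ → Y →L[𝕜] U}
    (hF : IsPeriodicFeedback T F) (τ : ℝ) :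
    ∃ K : ℝ, 0 ≤ K ∧ ∀ᵐ t, t ∈ Ioc 0 τ → ‖F t‖ ≤ K := by
  obtain ⟨K, hK⟩ := hF.locallyBounded (Icc T (τ + T)) isCompact_Icc
    fun t ht => lt_of_lt_of_le hT ht.1
  have hper := hF.periodic
  rw [ae_restrict_iff' measurableSet_Icc] at hK
  rw [ae_restrict_iff' measurableSet_Ioi] at hper
  have hK' := (measurePreserving_add_right volume T).quasiMeasurePreserving.ae hK
  refine ⟨max K 0, le_max_right _ _, ?_⟩
  filter_upwards [hK', hper] with t h1 h2 ht
  rw [← h2 ht.1]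
  exact (h1 ⟨by linarith [ht.1], by linarith [ht.2]⟩).trans (le_max_left _ _)

theorem exists_weakObservabilityInequality (S : C0Semigroup 𝕜 Y) (B : U →L[𝕜] Y) {T : ℝ}
    (hT : 0 < T) (h : IsDPStabilizable S B T) :
    ∃ T δ C : ℝ, 0 < T ∧ 0 < δ ∧ δ < 1 ∧ 0 ≤ C ∧ WeakObservabilityInequality S B T C δ := by
  obtain ⟨F, hF, M, ω, hM, hω, hstab⟩ := h
  -- The factor 2 anticipates (a + b)² ≤ 2a² + 2b², which also produces the 2 in C; C gets τ from
  -- Cauchy–Schwarz.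
  have hlim : Tendsto (fun τ : ℝ => 2 * (M * Real.exp (-(ω * τ))) ^ 2) atTop (𝓝 0) := by
    have h1 : Tendsto (fun τ : ℝ => Real.exp (-(ω * τ))) atTop (𝓝 0) :=
      Real.tendsto_exp_neg_atTop_nhds_zero.comp (tendsto_id.const_mul_atTop hω)
    simpa using ((h1.const_mul M).pow 2).const_mul 2
  obtain ⟨τ, hτ1, hτ⟩ := ((hlim.eventually (gt_mem_nhds (show (0:ℝ) < 1 / 2 by norm_num))).and
    (eventually_gt_atTop 0)).exists
  obtain ⟨K, hK0, hK⟩ := hF.exists_ae_bound hT τ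
  refine ⟨τ, 1 / 2, 2 * ((K * M) ^ 2 * τ), hτ, by norm_num, by norm_num, by positivity,
    fun φ => ?_⟩
  set w : ℝ → ℝ := fun s => ‖B.adjoint ((S.ext (τ - s)).adjoint φ)‖ with hw
  have hwc : Continuous w := by
    have := (S.continuous_adjoint_ext φ).comp 
      (show Continuous fun s : ℝ => τ - s by fun_prop)
    exact (B.adjoint.continuous.comp this).norm
  have hint : ∫ t in (0:ℝ)..τ, ‖B.adjoint ((S.op (τ - t)).adjoint φ)‖ ^ 2 =
      ∫ t in (0:ℝ)..τ, w t ^ 2 := by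
    refine intervalIntegral.integral_congr fun s hs => ?_
    rw [uIcc_of_le hτ.le] at hs
    simp only [hw]
    rw [S.ext_of_nonneg (sub_nonneg.2 hs.2)]
  rw [hint]
  set I := ∫ s in (0:ℝ)..τ, w s with hI
  have hI0 : 0 ≤ I := intervalIntegral.integral_nonneg hτ.le fun _ _ => norm_nonneg _
  have key : ∀ y₀, ‖inner 𝕜 φ (S.op τ y₀)‖ ≤
      (M * Real.exp (-(ω * τ)) * ‖φ‖ + K * M * I) * ‖y₀‖ := by
    intro y₀
    obtain ⟨⟨y, hy⟩, hall⟩ := hstab y₀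
    have hbound := hall y hy
    have hd := hy.duhamel τ hτ.le
    have h1 : ‖inner 𝕜 φ (∫ s in (0:ℝ)..τ, S.op (τ - s) (B (F s (sampleHold T y s))))‖ ≤
        ∫ s in (0:ℝ)..τ, K * M * ‖y₀‖ * w s := by
      refine norm_inner_intervalIntegral_le hτ.le φ
        ((hwc.const_mul _).intervalIntegrable _ _) (fun s => by positivity) ?_
      filter_upwards [hK] with s hs hsτ
      have hyb : ‖sampleHold T y s‖ ≤ M * ‖y₀‖ := by
        have h0 : 0 ≤ (⌊s / T⌋₊ : ℝ) * T := by positivity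
        refine (hbound _ h0).trans ?_
        have : Real.exp (-(ω * ((⌊s / T⌋₊ : ℝ) * T))) ≤ 1 :=
          Real.exp_le_one_iff.2 (neg_nonpos.2 (by positivity))
        have := mul_le_mul_of_nonneg_left this hM.le
        rw [mul_one] at this
        gcongr
      have hu : ‖F s (sampleHold T y s)‖ ≤ K * (M * ‖y₀‖) :=
        ((F s).le_of_opNorm_le (hs hsτ) _).trans (mul_le_mul_of_nonneg_left hyb hK0)
      rw [← S.ext_of_nonneg (sub_nonneg.2 hsτ.2), ← ContinuousLinearMap.adjoint_inner_left,
        ← ContinuousLinearMap.adjoint_inner_left]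
      refine (norm_inner_le_norm _ _).trans ?_
      calc _ ≤ w s * (K * (M * ‖y₀‖)) := mul_le_mul_of_nonneg_left hu (norm_nonneg _)
        _ = _ := by ring
    rw [intervalIntegral.integral_const_mul] at h1
    have h2 : inner 𝕜 φ (S.op τ y₀) = inner 𝕜 φ (y τ) -
        inner 𝕜 φ (∫ s in (0:ℝ)..τ, S.op (τ - s) (B (F s (sampleHold T y s)))) := by
      rw [hd, inner_add_right, add_sub_cancel_right]
    have h3 : ‖inner 𝕜 φ (y τ)‖ ≤ ‖φ‖ * (M * Real.exp (-(ω * τ)) * ‖y₀‖) :=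
      (norm_inner_le_norm _ _).trans (mul_le_mul_of_nonneg_left (hbound τ hτ.le) (norm_nonneg _))
    rw [h2]
    refine (norm_sub_le _ _).trans ?_
    linarith
  have hnorm : ‖(S.op τ).adjoint φ‖ ≤ M * Real.exp (-(ω * τ)) * ‖φ‖ + K * M * I := by
    set ψ := (S.op τ).adjoint φ with hψ
    -- The initial state y₀ = S(τ)*φ turns the duality bound into a norm bound.
    have h1 := key ψ
    rw [← ContinuousLinearMap.adjoint_inner_left, ← hψ, inner_self_eq_norm_sq_to_K, norm_pow,
      RCLike.norm_ofReal, abs_norm] at h1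
    by_cases h0 : ‖ψ‖ = 0
    · rw [h0]; positivity
    · exact le_of_mul_le_mul_right (by linarith) (lt_of_le_of_ne (norm_nonneg ψ) (Ne.symm h0))
  have hsq := sq_intervalIntegral_le hwc hτ
  rw [← hI] at hsq
  have h4 := pow_le_pow_left₀ (norm_nonneg _) hnorm 2
  have h5 := mul_le_mul_of_nonneg_left hsq (show 0 ≤ 2 * (K * M) ^ 2 by positivity)
  have h6 := mul_le_mul_of_nonneg_right hτ1.le (sq_nonneg ‖φ‖)
  have h7 := sq_nonneg (M * Real.exp (-(ω * τ)) * ‖φ‖ - K * M * I)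
  nlinarith

end Necessity

/-! ### Mild solutions of the inhomogeneous equation -/

section Duhamel

variable {𝕜 Y : Type*} [RCLike 𝕜]
  [NormedAddCommGroup Y] [InnerProductSpace 𝕜 Y] [CompleteSpace Y] [NormedSpace ℝ Y]

/-- Bounded on compact subintervals of `[0, ∞)`. -/
def LocallyBoundedOnHalfLine (f : ℝ → Y) : Prop :=
  ∀ R : ℝ, ∃ K : ℝ, 0 ≤ K ∧ ∀ s, 0 ≤ s → s ≤ R → ‖f s‖ ≤ K

namespace C0Semigroup

variable (S : C0Semigroup 𝕜 Y)

/-- The mild solution of `y' = A y + f`, `y(0) = y₀`. -/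
noncomputable def mild (y₀ : Y) (f : ℝ → Y) (t : ℝ) : Y :=
  S.ext t y₀ + ∫ s in (0 : ℝ)..t, S.ext (t - s) (f s)

omit [NormedSpace ℝ Y] in
theorem stronglyMeasurable_ext_sub_apply {f : ℝ → Y} (hf : StronglyMeasurable f) (t : ℝ) :
    StronglyMeasurable fun s => S.ext (t - s) (f s) := by
  have h1 : StronglyMeasurable fun s : ℝ => t - s :=
    (continuous_const.sub continuous_id).stronglyMeasurable
  exact (continuous_uncurry_of_continuous_orbits S.continuous_ext).comp_stronglyMeasurable
    (h1.prodMk hf)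

omit [NormedSpace ℝ Y] in
theorem intervalIntegrable_ext_sub_apply {f : ℝ → Y} (hf : StronglyMeasurable f)
    (hb : LocallyBoundedOnHalfLine f) (t : ℝ) {a b : ℝ} (ha : 0 ≤ a) (hab : a ≤ b) :
    IntervalIntegrable (fun s => S.ext (t - s) (f s)) volume a b := by
  obtain ⟨M, hM0, hM⟩ := exists_norm_le_of_continuous_orbits S.continuous_ext (t - b) (t - a)
  obtain ⟨K, hK0, hK⟩ := hb b
  rw [intervalIntegrable_iff_integrableOn_Ioc_of_le hab]
  refine Measure.integrableOn_of_bounded (M := M * K) (by simp)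
    (S.stronglyMeasurable_ext_sub_apply hf t).aestronglyMeasurable ?_
  rw [ae_restrict_iff' measurableSet_Ioc]
  refine Eventually.of_forall fun s hs => ?_
  refine ((S.ext (t - s)).le_of_opNorm_le (hM _ ⟨?_, ?_⟩) _).trans
    (mul_le_mul_of_nonneg_left (hK s (ha.trans hs.1.le) hs.2) hM0)
  · linarith [hs.2]
  · linarith [hs.1]

theorem mild_add [IsScalarTower ℝ 𝕜 Y] {f : ℝ → Y} (hf : StronglyMeasurable f)
    (hb : LocallyBoundedOnHalfLine f) (y₀ : Y) {a r : ℝ} (ha : 0 ≤ a) (hr : 0 ≤ r) :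
    S.mild y₀ f (a + r) = S.mild (S.mild y₀ f a) (fun s => f (a + s)) r := by
  have h1 := S.intervalIntegrable_ext_sub_apply hf hb (a + r) le_rfl ha
  have h2 := S.intervalIntegrable_ext_sub_apply hf hb (a + r) ha (le_add_of_nonneg_right hr)
  have h3 := S.intervalIntegrable_ext_sub_apply hf hb a le_rfl ha
  unfold mild
  rw [← intervalIntegral.integral_add_adjacent_intervals h1 h2, add_comm a r,
    S.ext_add_apply hr ha, map_add, add_assoc]
  congr 1
  congr 1
  · rw [← (S.ext r).intervalIntegral_comp_comm h3]
    refine intervalIntegral.integral_congr fun s hs => ?_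
    rw [uIcc_of_le ha] at hs
    rw [← S.ext_add_apply hr (sub_nonneg.2 hs.2), add_sub_assoc]
  · have := intervalIntegral.integral_comp_add_left (a := 0) (b := r)
      (fun s => S.ext (r + a - s) (f s)) a
    rw [add_zero, add_comm a r] at this
    rw [← this]
    refine intervalIntegral.integral_congr fun s _ => ?_
    congr 2
    ring

/-- The variable endpoint is moved into an indicator on the fixed interval [0, t₀+1]; dominated
convergence applies, the integrand being continuous in t at t₀ for every s ≠ t₀. -/
theorem continuousOn_mild {f : ℝ → Y} (hf : StronglyMeasurable f)
    (hb : LocallyBoundedOnHalfLine f) (y₀ : Y) : ContinuousOn (S.mild y₀ f) (Ici 0) := by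
  refine (S.continuous_ext y₀).continuousOn.add fun t₀ ht₀ => ?_
  have ht₀' : 0 ≤ t₀ := ht₀
  obtain ⟨M, hM0, hM⟩ :=
    exists_norm_le_of_continuous_orbits S.continuous_ext (-2) (t₀ + 1)
  obtain ⟨K, hK0, hK⟩ := hb (t₀ + 1)
  have hcont : ContinuousAt (fun t => ∫ s in (0:ℝ)..(t₀ + 1),
      indicator {x | x ≤ t} (fun s => S.ext (t - s) (f s)) s) t₀ := by
    refine intervalIntegral.continuousAt_of_dominated_interval (bound := fun _ => M * K) ?_ ?_
      intervalIntegrable_const ?_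
    · exact Eventually.of_forall fun t =>
        ((S.stronglyMeasurable_ext_sub_apply hf t).indicator measurableSet_Iic).aestronglyMeasurable
    · filter_upwards [Icc_mem_nhds (show t₀ - 1 < t₀ by linarith) (show t₀ < t₀ + 1 by linarith)]
        with t ht
      refine Eventually.of_forall fun s hs => ?_
      rw [uIoc_of_le (by linarith)] at hs
      refine (norm_indicator_le_norm_self _ _).trans ?_
      refine ((S.ext (t - s)).le_of_opNorm_le (hM _ ⟨?_, ?_⟩) _).trans
        (mul_le_mul_of_nonneg_left (hK s hs.1.le hs.2) hM0)
      · linarith [hs.2, ht.1]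
      · linarith [hs.1, ht.2]
    · filter_upwards [(countable_singleton t₀).ae_notMem volume] with s hs _
      rcases lt_or_gt_of_ne (show s ≠ t₀ from hs) with h | h
      · have : (fun t => S.ext (t - s) (f s)) =ᶠ[𝓝 t₀]
            fun t => indicator {x | x ≤ t} (fun s => S.ext (t - s) (f s)) s := by
          filter_upwards [lt_mem_nhds h] with t ht
          rw [indicator_of_mem (show s ∈ {x | x ≤ t} from le_of_lt ht)]
        refine ContinuousAt.congr ?_ this
        exact ((S.continuous_ext (f s)).comp (continuous_id.sub continuous_const)).continuousAt
      · have : (fun _ => (0 : Y)) =ᶠ[𝓝 t₀]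
            fun t => indicator {x | x ≤ t} (fun s => S.ext (t - s) (f s)) s := by
          filter_upwards [gt_mem_nhds h] with t ht
          rw [indicator_of_notMem (show s ∉ {x | x ≤ t} from not_le.2 ht)]
        exact continuousAt_const.congr this
  refine hcont.continuousWithinAt.congr_of_eventuallyEq ?_ ?_
  · filter_upwards [self_mem_nhdsWithin,
      mem_nhdsWithin_of_mem_nhds (gt_mem_nhds (show t₀ < t₀ + 1 by linarith))] with t ht ht'
    exact (intervalIntegral.integral_indicator ⟨ht, le_of_lt ht'⟩).symm
  · exact (intervalIntegral.integral_indicator ⟨ht₀', by linarith⟩).symm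

end C0Semigroup

end Duhamel

/-! ### Gramian, observed energy and the sampled closed loop -/

section Sufficiency

open ContinuousLinearMap (adjoint)

variable {𝕜 Y U : Type*} [RCLike 𝕜]
  [NormedAddCommGroup Y] [InnerProductSpace 𝕜 Y] [CompleteSpace Y]
  [NormedSpace ℝ Y] [IsScalarTower ℝ 𝕜 Y]
  [NormedAddCommGroup U] [InnerProductSpace 𝕜 U] [CompleteSpace U]

namespace C0Semigroup

variable (S : C0Semigroup 𝕜 Y) (B : U →L[𝕜] Y)

theorem continuous_adjoint_ext_uncurry : Continuous fun p : ℝ × Y => adjoint (S.ext p.1) p.2 :=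
  continuous_uncurry_of_continuous_orbits (K := fun t => adjoint (S.ext t))
    S.continuous_adjoint_ext

theorem continuous_observation (φ : Y) : Continuous fun r => adjoint B (adjoint (S.ext r) φ) :=
  (adjoint B).continuous.comp (S.continuous_adjoint_ext φ)

theorem continuous_gramian_integrand (φ : Y) : Continuous fun r =>
    ((S.ext r).comp (B.comp ((adjoint B).comp (adjoint (S.ext r))))) φ :=
  (continuous_uncurry_of_continuous_orbits S.continuous_ext).comp
    (continuous_id.prodMk (B.continuous.comp (S.continuous_observation B φ)))

/-- The controllability Gramian `∫₀ᵀ S(r) B B* S(r)* dr`. -/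
noncomputable def gramian (T : ℝ) : Y →L[𝕜] Y :=
  strongIntegral (fun r => (S.ext r).comp (B.comp ((adjoint B).comp (adjoint (S.ext r)))))
    (S.continuous_gramian_integrand B) 0 T

/-- The observed energy `∫₀^τ ‖B* S(r)* φ‖² dr`. -/
noncomputable def observedEnergy (τ : ℝ) (φ : Y) : ℝ :=
  ∫ r in (0:ℝ)..τ, ‖adjoint B (adjoint (S.ext r) φ)‖ ^ 2

theorem inner_gramian (T : ℝ) (φ ψ : Y) : inner 𝕜 ψ (S.gramian B T φ) =
    ∫ r in (0:ℝ)..T, inner 𝕜 (adjoint B (adjoint (S.ext r) ψ)) (adjoint B (adjoint (S.ext r) φ)) := by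
  have h := (innerSL 𝕜 ψ).intervalIntegral_comp_comm
    ((S.continuous_gramian_integrand B φ).intervalIntegrable (μ := volume) 0 T)
  simp only [innerSL_apply_apply] at h
  rw [gramian, strongIntegral_apply, ← h]
  refine intervalIntegral.integral_congr fun r _ => ?_
  simp only [ContinuousLinearMap.comp_apply, ContinuousLinearMap.adjoint_inner_left]

theorem reApplyInnerSelf_gramian (T : ℝ) (φ : Y) :
    (S.gramian B T).reApplyInnerSelf φ = S.observedEnergy B T φ := by
  rw [ContinuousLinearMap.reApplyInnerSelf_apply, ← inner_conj_symm, RCLike.conj_re, inner_gramian]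
  simp only [inner_self_eq_norm_sq_to_K, ← RCLike.ofReal_pow]
  simp only [intervalIntegral, integral_ofReal, map_sub, RCLike.ofReal_re, observedEnergy]

theorem isPositive_gramian {T : ℝ} (hT : 0 ≤ T) : (S.gramian B T).IsPositive := by
  refine ⟨fun φ ψ => ?_, fun φ => ?_⟩
  · change inner 𝕜 (S.gramian B T φ) ψ = inner 𝕜 φ (S.gramian B T ψ)
    rw [← inner_conj_symm, inner_gramian, inner_gramian]
    simp only [intervalIntegral.integral_of_le hT]
    rw [← integral_conj]
    simp only [inner_conj_symm]
  · rw [reApplyInnerSelf_gramian]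
    exact intervalIntegral.integral_nonneg hT fun _ _ => sq_nonneg _

theorem observedEnergy_add {a b : ℝ} (ha : 0 ≤ a) (hb : 0 ≤ b) (φ : Y) :
    S.observedEnergy B (a + b) φ =
      S.observedEnergy B a φ + S.observedEnergy B b (adjoint (S.ext a) φ) := by
  have hint : ∀ c d, IntervalIntegrable (fun r => ‖adjoint B (adjoint (S.ext r) φ)‖ ^ 2)
      volume c d := fun c d =>
    ((S.continuous_observation B φ).norm.pow 2).intervalIntegrable _ _
  unfold observedEnergy
  rw [← intervalIntegral.integral_add_adjacent_intervals (hint 0 a) (hint a (a + b))]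
  congr 1
  have := intervalIntegral.integral_comp_add_left (a := 0) (b := b)
    (fun r => ‖adjoint B (adjoint (S.ext r) φ)‖ ^ 2) a
  rw [add_zero] at this
  rw [← this]
  refine intervalIntegral.integral_congr fun s hs => ?_
  rw [uIcc_of_le hb] at hs
  simp only [S.adjoint_ext_add_apply ha hs.1]

omit [NormedSpace ℝ Y] [IsScalarTower ℝ 𝕜 Y] in
theorem observedEnergy_nonneg {a : ℝ} (ha : 0 ≤ a) (φ : Y) : 0 ≤ S.observedEnergy B a φ :=
  intervalIntegral.integral_nonneg ha fun _ _ => sq_nonneg _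

omit [NormedSpace ℝ Y] [IsScalarTower ℝ 𝕜 Y] in
theorem adjoint_ext_pow_apply {T : ℝ} (hT : 0 ≤ T) (k : ℕ) (φ : Y) :
    (adjoint (S.ext T) ^ k) φ = adjoint (S.ext (k * T)) φ := by
  induction k with
  | zero =>
    have h : adjoint (ContinuousLinearMap.id 𝕜 Y) = ContinuousLinearMap.id 𝕜 Y :=
      ContinuousLinearMap.adjoint_id
    simp [S.ext_zero, h]
  | succ k ih =>
    rw [pow_succ', ContinuousLinearMap.mul_def, ContinuousLinearMap.comp_apply, ih,
      ← S.adjoint_ext_add_apply (by positivity) hT]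
    push_cast
    rw [add_mul, one_mul]

/-- Consecutive windows of length T tile [0, NT]; this links continuous and discrete observability.
-/
theorem sum_reApplyInnerSelf_gramian {T : ℝ} (hT : 0 ≤ T) (N : ℕ) (φ : Y) :
    ∑ k ∈ Finset.range N, (S.gramian B T).reApplyInnerSelf ((adjoint (S.ext T) ^ k) φ) =
      S.observedEnergy B (N * T) φ := by
  induction N with
  | zero => simp [observedEnergy]
  | succ N ih =>
    rw [Finset.sum_range_succ, ih, reApplyInnerSelf_gramian, S.adjoint_ext_pow_apply hT]
    push_cast
    rw [add_mul, one_mul, S.observedEnergy_add B (by positivity) hT]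

omit [NormedSpace ℝ Y] [IsScalarTower ℝ 𝕜 Y] in
theorem weakObservabilityInequality_iff {T : ℝ} (hT : 0 ≤ T) (C δ : ℝ) :
    WeakObservabilityInequality S B T C δ ↔ ∀ φ, ‖adjoint (S.ext T) φ‖ ^ 2 ≤
      C * S.observedEnergy B T φ + δ * ‖φ‖ ^ 2 := by
  refine forall_congr' fun φ => ?_
  have h1 : ∫ t in (0 : ℝ)..T, ‖adjoint B (adjoint (S.op (T - t)) φ)‖ ^ 2 =
      S.observedEnergy B T φ := by
    have := intervalIntegral.integral_comp_sub_left (a := 0) (b := T)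
      (fun r => ‖adjoint B (adjoint (S.ext r) φ)‖ ^ 2) T
    rw [sub_zero, sub_self] at this
    rw [observedEnergy, ← this]
    refine intervalIntegral.integral_congr fun s hs => ?_
    rw [uIcc_of_le hT] at hs
    rw [S.ext_of_nonneg (sub_nonneg.2 hs.2)]
  rw [h1, S.ext_of_nonneg hT]

/-- Apply the bound for m periods to S(T)*φ, then the one-period bound; the weight δ^m on the new
energy is dropped. -/
theorem observability_iterate {T C δ : ℝ} (hT : 0 ≤ T) (hC : 0 ≤ C) (hδ0 : 0 ≤ δ) (hδ : δ ≤ 1)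
    (h : ∀ φ, ‖adjoint (S.ext T) φ‖ ^ 2 ≤ C * S.observedEnergy B T φ + δ * ‖φ‖ ^ 2) (m : ℕ)
    (φ : Y) : ‖adjoint (S.ext (m * T)) φ‖ ^ 2 ≤
      m * C * S.observedEnergy B (m * T) φ + δ ^ m * ‖φ‖ ^ 2 := by
  induction m generalizing φ with
  | zero =>
    rw [← S.adjoint_ext_pow_apply hT]
    simp
  | succ m ih =>
    have h0 : ((m + 1 : ℕ) : ℝ) * T = T + m * T := by push_cast; ring
    rw [h0, S.adjoint_ext_add_apply hT (by positivity),
      S.observedEnergy_add B hT (by positivity)]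
    have h1 := ih (adjoint (S.ext T) φ)
    have hp : 0 ≤ δ ^ m := by positivity
    have h2 := mul_le_mul_of_nonneg_left (h φ) hp
    have h3 := S.observedEnergy_nonneg B hT φ
    have h4 := S.observedEnergy_nonneg B (show 0 ≤ m * T by positivity) (adjoint (S.ext T) φ)
    have h5 : δ ^ m * (C * S.observedEnergy B T φ) ≤ C * S.observedEnergy B T φ :=
      mul_le_of_le_one_left (by positivity) (pow_le_one₀ hδ0 hδ)
    have h6 : 0 ≤ m * C * S.observedEnergy B T φ := by positivity
    have h7 : 0 ≤ C * S.observedEnergy B (m * T) (adjoint (S.ext T) φ) := by positivity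
    rw [pow_succ δ m]
    push_cast
    linarith

/-- A weak observability inequality at some time yields one at a multiple of any given period. -/
theorem exists_observability_multiple {T₀ C δ : ℝ} (hT₀ : 0 < T₀) (hC : 0 ≤ C) (hδ0 : 0 < δ)
    (hδ : δ < 1)
    (h : ∀ φ, ‖adjoint (S.ext T₀) φ‖ ^ 2 ≤ C * S.observedEnergy B T₀ φ + δ * ‖φ‖ ^ 2)
    {T : ℝ} (hT : 0 < T) :
    ∃ (N : ℕ) (C' δ' : ℝ), 0 < N ∧ 0 ≤ C' ∧ 0 < δ' ∧ δ' < 1 ∧ ∀ φ,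
      ‖adjoint (S.ext (N * T)) φ‖ ^ 2 ≤ C' * S.observedEnergy B (N * T) φ + δ' * ‖φ‖ ^ 2 := by
  obtain ⟨M, hM0, hM⟩ := exists_norm_le_of_continuous_orbits S.continuous_ext 0 (2 * T)
  -- NT overshoots mT₀ by some r ≤ 2T, costing a factor M², which δ^m must beat. The +1 in N keeps
  -- it positive, and the maximum with 1/2 keeps δ' positive.
  obtain ⟨m, hm⟩ := exists_pow_lt_of_lt_one (show 0 < 1 / (M ^ 2 + 1) by positivity) hδ
  have hm' : M ^ 2 * δ ^ m < 1 := by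
    rw [lt_div_iff₀ (by positivity)] at hm
    nlinarith [pow_pos hδ0 m]
  set N := ⌈m * T₀ / T⌉₊ + 1 with hN
  have hceil := Nat.le_ceil (m * T₀ / T)
  have hceil' := Nat.ceil_lt_add_one (show 0 ≤ m * T₀ / T by positivity)
  rw [div_le_iff₀ hT] at hceil
  have hNT : (N : ℝ) * T = ⌈m * T₀ / T⌉₊ * T + T := by rw [hN]; push_cast; ring
  have hr0 : 0 ≤ N * T - m * T₀ := by rw [hNT]; linarith
  have hr1 : N * T - m * T₀ ≤ 2 * T := by
    have := mul_lt_mul_of_pos_right hceil' hT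
    rw [add_mul, div_mul_cancel₀ _ hT.ne'] at this
    rw [hNT]; linarith
  have hmT : (0:ℝ) ≤ m * T₀ := by positivity
  refine ⟨N, M ^ 2 * (m * C), max (M ^ 2 * δ ^ m) (1 / 2), Nat.succ_pos _, by positivity,
    lt_max_of_lt_right (by norm_num), max_lt hm' (by norm_num), fun φ => ?_⟩
  have hsplit : (N : ℝ) * T = m * T₀ + (N * T - m * T₀) := by ring
  set r := (N : ℝ) * T - m * T₀
  have h1 := S.observability_iterate B hT₀.le hC hδ0.le hδ.le h m φ
  rw [hsplit, S.adjoint_ext_add_apply hmT hr0, S.observedEnergy_add B hmT hr0]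
  have hn : ‖adjoint (S.ext r)‖ ≤ M := by
    rw [LinearIsometryEquiv.norm_map]; exact hM r ⟨hr0, hr1⟩
  have h2 := pow_le_pow_left₀ (norm_nonneg _)
    ((adjoint (S.ext r)).le_of_opNorm_le hn (adjoint (S.ext (m * T₀)) φ)) 2
  rw [mul_pow] at h2
  have h3 := mul_le_mul_of_nonneg_left h1 (sq_nonneg M)
  have h4 := mul_le_mul_of_nonneg_right (le_max_left (M ^ 2 * δ ^ m) (1 / 2)) (sq_nonneg ‖φ‖)
  have h5 := mul_nonneg (show 0 ≤ M ^ 2 * (m * C) by positivity)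
    (S.observedEnergy_nonneg B hr0 (adjoint (S.ext (m * T₀)) φ))
  linarith

/-- The `T`-periodic feedback law `F(t) = B* S(T - t)* K`, `0 ≤ t < T`. -/
noncomputable def feedbackLaw (T : ℝ) (K : Y →L[𝕜] Y) (t : ℝ) : Y →L[𝕜] U :=
  (adjoint B).comp ((adjoint (S.ext (T * (1 - Int.fract (t / T))))).comp K)

omit [NormedSpace ℝ Y] [IsScalarTower ℝ 𝕜 Y] in
theorem feedbackLaw_add_nat_mul {T : ℝ} (hT : 0 < T) (K : Y →L[𝕜] Y) (k : ℕ) (t : ℝ) :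
    S.feedbackLaw B T K (k * T + t) = S.feedbackLaw B T K t := by
  unfold feedbackLaw
  rw [add_div, mul_div_cancel_right₀ _ hT.ne', Int.fract_natCast_add]

omit [NormedSpace ℝ Y] [IsScalarTower ℝ 𝕜 Y] in
theorem exists_norm_feedbackLaw_le {T : ℝ} (hT : 0 < T) (K : Y →L[𝕜] Y) :
    ∃ c : ℝ, 0 ≤ c ∧ ∀ t, ‖S.feedbackLaw B T K t‖ ≤ c := by
  obtain ⟨M, hM0, hM⟩ := exists_norm_le_of_continuous_orbits S.continuous_ext 0 T
  refine ⟨‖adjoint B‖ * (M * ‖K‖), by positivity, fun t => ?_⟩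
  refine (ContinuousLinearMap.opNorm_comp_le _ _).trans ?_
  gcongr
  refine (ContinuousLinearMap.opNorm_comp_le _ _).trans ?_
  gcongr
  rw [LinearIsometryEquiv.norm_map]
  have h0 := Int.fract_nonneg (t / T)
  have h1 := Int.fract_lt_one (t / T)
  exact hM _ ⟨mul_nonneg hT.le (by linarith), mul_le_of_le_one_right hT.le (by linarith)⟩

theorem stronglyMeasurable_feedbackLaw_apply (T : ℝ) (K : Y →L[𝕜] Y) {x : ℝ → Y}
    (hx : StronglyMeasurable x) : StronglyMeasurable fun t => S.feedbackLaw B T K t (x t) := by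
  have h1 : Measurable fun t : ℝ => T * (1 - Int.fract (t / T)) :=
    (((measurable_fract).comp (measurable_id.div_const T)).const_sub 1).const_mul T
  have h2 := S.continuous_adjoint_ext_uncurry.comp_stronglyMeasurable
    (h1.stronglyMeasurable.prodMk (K.continuous.comp_stronglyMeasurable hx))
  exact (adjoint B).continuous.comp_stronglyMeasurable h2

theorem isPeriodicFeedback_feedbackLaw {T : ℝ} (hT : 0 < T) (K : Y →L[𝕜] Y) :
    IsPeriodicFeedback T (S.feedbackLaw B T K) where
  aestronglyMeasurable x :=
    (S.stronglyMeasurable_feedbackLaw_apply B T K stronglyMeasurable_const).aestronglyMeasurable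
  locallyBounded _ _ _ := by
    obtain ⟨c, -, hc⟩ := S.exists_norm_feedbackLaw_le B hT K
    exact ⟨c, Eventually.of_forall hc⟩
  periodic := Eventually.of_forall fun t => by
    have := S.feedbackLaw_add_nat_mul B hT K 1 t
    rwa [Nat.cast_one, one_mul, add_comm] at this

/-- The input term of the closed loop system with sampled values `x`. -/
noncomputable def sampledInput (T : ℝ) (K : Y →L[𝕜] Y) (x : ℕ → Y) (s : ℝ) : Y :=
  B (S.feedbackLaw B T K s (x ⌊s / T⌋₊))

theorem stronglyMeasurable_sampledInput (T : ℝ) (K : Y →L[𝕜] Y) (x : ℕ → Y) :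
    StronglyMeasurable (S.sampledInput B T K x) := by
  have h1 : Measurable fun s : ℝ => ⌊s / T⌋₊ := Nat.measurable_floor.comp (measurable_id.div_const T)
  have h2 : StronglyMeasurable x := StronglyMeasurable.of_discrete
  exact B.continuous.comp_stronglyMeasurable
    (S.stronglyMeasurable_feedbackLaw_apply B T K (h2.comp_measurable h1))

omit [NormedSpace ℝ Y] [IsScalarTower ℝ 𝕜 Y] in
theorem locallyBounded_sampledInput {T : ℝ} (hT : 0 < T) (K : Y →L[𝕜] Y) (x : ℕ → Y) :
    LocallyBoundedOnHalfLine (S.sampledInput B T K x) := by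
  intro R
  obtain ⟨c, hc0, hc⟩ := S.exists_norm_feedbackLaw_le B hT K
  refine ⟨‖B‖ * (c * ∑ k ∈ Finset.range (⌊R / T⌋₊ + 1), ‖x k‖), by positivity, fun s _ hs => ?_⟩
  refine B.le_of_opNorm_le_of_le le_rfl (ContinuousLinearMap.le_of_opNorm_le_of_le _ (hc s) ?_)
  refine Finset.single_le_sum (f := fun k => ‖x k‖) (fun _ _ => norm_nonneg _) ?_
  rw [Finset.mem_range, Nat.lt_succ_iff]
  exact Nat.floor_le_floor (by gcongr)

/-- The state after time `r ≤ T`, starting at a sampling instant from the state `x`. -/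
noncomputable def samplingFlow (T : ℝ) (K : Y →L[𝕜] Y) (r : ℝ) (x : Y) : Y :=
  S.mild x (fun s => B (S.feedbackLaw B T K s x)) r

theorem mild_sampledInput_add {T : ℝ} (hT : 0 < T) (K : Y →L[𝕜] Y) {x : ℕ → Y} (y₀ : Y) {k : ℕ}
    (hx : S.mild y₀ (S.sampledInput B T K x) (k * T) = x k) {r : ℝ} (hr : 0 ≤ r) (hrT : r ≤ T) :
    S.mild y₀ (S.sampledInput B T K x) (k * T + r) = S.samplingFlow B T K r (x k) := by
  rw [S.mild_add (S.stronglyMeasurable_sampledInput B T K x)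
    (S.locallyBounded_sampledInput B hT K x) y₀ (by positivity) hr, hx]
  unfold samplingFlow mild
  congr 1
  refine intervalIntegral.integral_congr_ae ?_
  -- At s = T the floor already jumps to k + 1.
  filter_upwards [(countable_singleton T).ae_notMem volume] with s hs hsr
  rw [uIoc_of_le hr] at hsr
  have hsT : s < T := lt_of_le_of_ne (hsr.2.trans hrT) hs
  have hfl : ⌊((k:ℝ) * T + s) / T⌋₊ = k := by
    rw [add_div, mul_div_cancel_right₀ _ hT.ne', Nat.floor_eq_iff (by have := hsr.1; positivity)]
    exact ⟨le_add_of_nonneg_right (div_nonneg hsr.1.le hT.le),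
      by gcongr; rwa [div_lt_one hT]⟩
  rw [sampledInput, hfl, feedbackLaw_add_nat_mul _ _ hT]

/-- The substitution r = T - s turns the input integral under the law B*S(T-s)*K into the Gramian;
the jump of the fractional part at s = T is negligible. -/
theorem samplingFlow_period {T : ℝ} (hT : 0 < T) (K : Y →L[𝕜] Y) (x : Y) :
    S.samplingFlow B T K T x = (S.ext T + S.gramian B T * K) x := by
  change _ = S.ext T x + S.gramian B T (K x)
  unfold samplingFlow mild
  rw [gramian, strongIntegral_apply]
  congr 1
  have := intervalIntegral.integral_comp_sub_left (a := 0) (b := T) (fun r =>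
    ((S.ext r).comp (B.comp ((adjoint B).comp (adjoint (S.ext r))))) (K x)) T
  rw [sub_zero, sub_self] at this
  rw [← this]
  refine intervalIntegral.integral_congr_ae ?_
  filter_upwards [(countable_singleton T).ae_notMem volume] with s hs hsr
  rw [uIoc_of_le hT.le] at hsr
  have hsT : s < T := lt_of_le_of_ne hsr.2 hs
  have hfr : T * (1 - Int.fract (s / T)) = T - s := by
    rw [Int.fract_eq_self.2 ⟨div_nonneg hsr.1.le hT.le, (div_lt_one hT).2 hsT⟩]
    field_simp
  simp only [feedbackLaw, hfr, ContinuousLinearMap.comp_apply]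

omit [IsScalarTower ℝ 𝕜 Y] in
theorem exists_norm_samplingFlow_le {T : ℝ} (hT : 0 < T) (K : Y →L[𝕜] Y) :
    ∃ M : ℝ, 0 ≤ M ∧ ∀ r, 0 ≤ r → r ≤ T → ∀ x, ‖S.samplingFlow B T K r x‖ ≤ M * ‖x‖ := by
  obtain ⟨M, hM0, hM⟩ := exists_norm_le_of_continuous_orbits S.continuous_ext 0 T
  obtain ⟨c, hc0, hc⟩ := S.exists_norm_feedbackLaw_le B hT K
  refine ⟨M + M * (‖B‖ * c) * T, by positivity, fun r hr hrT x => ?_⟩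
  have h1 : ‖∫ s in (0:ℝ)..r, S.ext (r - s) (B (S.feedbackLaw B T K s x))‖ ≤
      M * (‖B‖ * (c * ‖x‖)) * |r - 0| := by
    refine intervalIntegral.norm_integral_le_of_norm_le_const fun s hs => ?_
    rw [uIoc_of_le hr] at hs
    refine ContinuousLinearMap.le_of_opNorm_le_of_le _
      (hM _ ⟨sub_nonneg.2 hs.2, by linarith [hs.1]⟩) ?_
    exact B.le_of_opNorm_le_of_le le_rfl (ContinuousLinearMap.le_of_opNorm_le _ (hc s) x)
  have h2 := (S.ext r).le_of_opNorm_le (hM r ⟨hr, hrT⟩) x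
  rw [sub_zero, abs_of_nonneg hr] at h1
  have h3 : M * (‖B‖ * (c * ‖x‖)) * r ≤ M * (‖B‖ * (c * ‖x‖)) * T := by gcongr
  refine (norm_add_le _ _).trans ?_
  linarith

omit [IsScalarTower ℝ 𝕜 Y] in
-- The input depends on y only through its samples, so prescribing a sample sequence makes the
-- right-hand side explicit.
theorem isSampledSolution_iff {T : ℝ} (K : Y →L[𝕜] Y) (y₀ : Y) (y : ℝ → Y) :
    IsSampledSolution S B T (S.feedbackLaw B T K) y₀ y ↔ ContinuousOn y (Ici 0) ∧
      ∀ t, 0 ≤ t → y t = S.mild y₀ (S.sampledInput B T K fun k => y (k * T)) t := by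
  have key : ∀ t, 0 ≤ t → S.op t y₀ + ∫ s in (0 : ℝ)..t,
      S.op (t - s) (B (S.feedbackLaw B T K s (sampleHold T y s))) =
      S.mild y₀ (S.sampledInput B T K fun k => y (k * T)) t := by
    intro t ht
    rw [mild, S.ext_of_nonneg ht]
    congr 1
    refine intervalIntegral.integral_congr fun s hs => ?_
    rw [uIcc_of_le ht] at hs
    simp only [S.ext_of_nonneg (sub_nonneg.2 hs.2)]
    rfl
  constructor
  · intro h
    exact ⟨h.continuousOn, fun t ht => by rw [h.duhamel t ht, key t ht]⟩
  · rintro ⟨h1, h2⟩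
    exact ⟨h1, fun t ht => by rw [key t ht, ← h2 t ht]⟩

/-- Only samples before n matter up to time nT. This causality drives the inductions for both
existence and uniqueness. -/
theorem mild_at_sampling_instants {T : ℝ} (hT : 0 < T) (K : Y →L[𝕜] Y) (y₀ : Y) {x : ℕ → Y}
    {n : ℕ} (hx : ∀ k < n, S.mild y₀ (S.sampledInput B T K x) (k * T) = x k) :
    S.mild y₀ (S.sampledInput B T K x) (n * T) =
      if n = 0 then y₀ else (S.ext T + S.gramian B T * K) (x (n - 1)) := by
  cases n with
  | zero => simp [mild, S.ext_zero]
  | succ n =>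
    have h := S.mild_sampledInput_add B hT K y₀ (hx n (Nat.lt_succ_self n)) hT.le le_rfl
    rw [S.samplingFlow_period B hT] at h
    rw [show ((n + 1 : ℕ) : ℝ) * T = n * T + T by push_cast; ring, h]
    simp

theorem exists_isSampledSolution {T : ℝ} (hT : 0 < T) (K : Y →L[𝕜] Y) (y₀ : Y) :
    ∃ y, IsSampledSolution S B T (S.feedbackLaw B T K) y₀ y := by
  set Q := S.ext T + S.gramian B T * K with hQ
  set x : ℕ → Y := fun k => (Q ^ k) y₀ with hxdef
  have hx : ∀ n : ℕ, S.mild y₀ (S.sampledInput B T K x) (n * T) = x n := by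
    intro n
    induction n using Nat.strong_induction_on with
    | _ n ih =>
      rw [S.mild_at_sampling_instants B hT K y₀ ih]
      cases n with
      | zero => simp [hxdef]
      | succ n => simp only [hxdef, pow_succ', Nat.succ_ne_zero, if_false, Nat.add_sub_cancel]; rfl
  refine ⟨S.mild y₀ (S.sampledInput B T K x), (S.isSampledSolution_iff B K y₀ _).2
    ⟨S.continuousOn_mild (S.stronglyMeasurable_sampledInput B T K x)
      (S.locallyBounded_sampledInput B hT K x) y₀, fun t _ => ?_⟩⟩
  simp only [hx]

theorem solution_eq_samplingFlow {T : ℝ} (hT : 0 < T) (K : Y →L[𝕜] Y) {y₀ : Y} {y : ℝ → Y}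
    (hy : IsSampledSolution S B T (S.feedbackLaw B T K) y₀ y) (k : ℕ) {r : ℝ} (hr : 0 ≤ r)
    (hrT : r ≤ T) : y (k * T + r) =
      S.samplingFlow B T K r (((S.ext T + S.gramian B T * K) ^ k) y₀) := by
  obtain ⟨-, hd⟩ := (S.isSampledSolution_iff B K y₀ y).1 hy
  have hx : ∀ n : ℕ, S.mild y₀ (S.sampledInput B T K fun k => y (k * T)) (n * T) = y (n * T) :=
    fun n => (hd _ (by positivity)).symm
  have hpow : ∀ n : ℕ, y (n * T) = ((S.ext T + S.gramian B T * K) ^ n) y₀ := by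
    intro n
    induction n with
    | zero => rw [← hx, S.mild_at_sampling_instants B hT K y₀ fun k _ => hx k]; simp
    | succ n ih =>
      rw [← hx, S.mild_at_sampling_instants B hT K y₀ fun k _ => hx k]
      simp only [Nat.succ_ne_zero, if_false, Nat.add_sub_cancel, ih, pow_succ']
      rfl
  rw [hd _ (by positivity), S.mild_sampledInput_add B hT K y₀ (hx k) hr hrT, hpow]

end C0Semigroup

theorem isDPStabilizable_of_power_stable (S : C0Semigroup 𝕜 Y) (B : U →L[𝕜] Y) {T : ℝ}
    (hT : 0 < T) {K : Y →L[𝕜] Y} {c σ : ℝ} (hc : 0 ≤ c) (hσ0 : 0 < σ) (hσ1 : σ < 1)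
    (h : ∀ k x, ‖((S.ext T + S.gramian B T * K) ^ k) x‖ ^ 2 ≤ c * σ ^ k * ‖x‖ ^ 2) :
    IsDPStabilizable S B T := by
  obtain ⟨M, hM0, hM⟩ := S.exists_norm_samplingFlow_le B hT K
  -- Chosen so that e^{-2ωT} = σ, since the power bound is on squared norms.
  set ω := -Real.log σ / (2 * T) with hω
  have hω0 : 0 < ω := div_pos (neg_pos.2 (Real.log_neg hσ0 hσ1)) (by positivity)
  have hexp : ∀ k : ℕ, Real.exp (-(ω * (k * T))) ^ 2 = σ ^ k := by
    intro k
    rw [← Real.exp_nat_mul, ← Real.exp_log (pow_pos hσ0 k), Real.log_pow, hω]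
    congr 1
    field_simp
    push_cast
    ring
  -- The 1/σ pays for rounding t up to (k+1)T; the +1 makes the constant positive.
  refine ⟨S.feedbackLaw B T K, S.isPeriodicFeedback_feedbackLaw B hT K,
    Real.sqrt (M ^ 2 * c / σ) + 1, ω, by positivity, hω0, fun y₀ =>
    ⟨S.exists_isSampledSolution B hT K y₀, fun y hy t ht => ?_⟩⟩
  set k := ⌊t / T⌋₊ with hk
  have hk1 : k * T ≤ t := by
    rw [← le_div_iff₀ hT]; exact Nat.floor_le (by positivity)
  have hk2 : t ≤ (k + 1 : ℕ) * T := by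
    rw [← div_le_iff₀ hT]; push_cast; exact (Nat.lt_floor_add_one _).le
  have hyt := S.solution_eq_samplingFlow B hT K hy k (r := t - k * T) (by linarith)
    (by push_cast at hk2; linarith)
  rw [add_sub_cancel] at hyt
  have h1 := hM (t - k * T) (by linarith) (by push_cast at hk2; linarith)
    (((S.ext T + S.gramian B T * K) ^ k) y₀)
  rw [← hyt] at h1
  have h2 := pow_le_pow_left₀ (norm_nonneg _) h1 2
  rw [mul_pow] at h2
  have h3 := mul_le_mul_of_nonneg_left (h k y₀) (sq_nonneg M)
  have h4 : σ ^ k ≤ Real.exp (-(ω * t)) ^ 2 / σ := by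
    rw [le_div_iff₀ hσ0, ← pow_succ, ← hexp (k + 1)]
    gcongr
  have h5 : M ^ 2 * c / σ ≤ (Real.sqrt (M ^ 2 * c / σ) + 1) ^ 2 := by
    have := Real.sq_sqrt (show 0 ≤ M ^ 2 * c / σ by positivity)
    nlinarith [Real.sqrt_nonneg (M ^ 2 * c / σ)]
  refine le_of_sq_le_sq ?_ (by positivity)
  calc ‖y t‖ ^ 2 ≤ M ^ 2 * (c * σ ^ k * ‖y₀‖ ^ 2) := h2.trans h3
    _ ≤ M ^ 2 * (c * (Real.exp (-(ω * t)) ^ 2 / σ) * ‖y₀‖ ^ 2) := by gcongr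
    _ = (M ^ 2 * c / σ) * (Real.exp (-(ω * t)) ^ 2 * ‖y₀‖ ^ 2) := by ring
    _ ≤ (Real.sqrt (M ^ 2 * c / σ) + 1) ^ 2 * (Real.exp (-(ω * t)) ^ 2 * ‖y₀‖ ^ 2) := by gcongr
    _ = _ := by ring

theorem isDPStabilizable_of_weakObservabilityInequality (S : C0Semigroup 𝕜 Y) (B : U →L[𝕜] Y)
    {T₀ δ C : ℝ} (hT₀ : 0 < T₀) (hδ0 : 0 < δ) (hδ : δ < 1) (hC : 0 ≤ C)
    (h : WeakObservabilityInequality S B T₀ C δ) {T : ℝ} (hT : 0 < T) :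
    IsDPStabilizable S B T := by
  obtain ⟨N, C', δ', hN, hC', hδ0', hδ', hobs⟩ := S.exists_observability_multiple B hT₀ hC hδ0 hδ
    ((S.weakObservabilityInequality_iff B hT₀.le C δ).1 h) hT
  obtain ⟨K, c, σ, hc, hσ0, hσ1, hK⟩ := exists_stabilizing_feedback (S.ext T) (S.gramian B T)
    (S.isPositive_gramian B hT.le) hN hC' hδ0' hδ' fun φ => by
      rw [S.adjoint_ext_pow_apply hT.le, S.sum_reApplyInnerSelf_gramian B hT.le]
      exact hobs φ
  exact isDPStabilizable_of_power_stable S B hT hc hσ0 hσ1 hK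

end Sufficiency

/-- `A` generates the `C₀`-semigroup `S` on the Hilbert space `Y` and `B ∈ 𝓛(U; Y)`. The scalar
field `𝕜` is `ℝ` or `ℂ`; `[NormedSpace ℝ Y] [IsScalarTower ℝ 𝕜 Y]` is the underlying real
structure of `Y` (unique), which Mathlib's Bochner integral refers to. -/
theorem theorem1p8 {𝕜 Y U : Type*} [RCLike 𝕜]
    [NormedAddCommGroup Y] [InnerProductSpace 𝕜 Y] [CompleteSpace Y]
    [NormedSpace ℝ Y] [IsScalarTower ℝ 𝕜 Y]
    [NormedAddCommGroup U] [InnerProductSpace 𝕜 U] [CompleteSpace U]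
    (A : Y →ₗ.[𝕜] Y) (S : C0Semigroup 𝕜 Y) (hA : S.IsGeneratedBy A) (B : U →L[𝕜] Y) :
    List.TFAE
      [∀ T : ℝ, 0 < T → IsDPStabilizable S B T,
       ∃ T : ℝ, 0 < T ∧ IsDPStabilizable S B T,
       ∃ T δ C : ℝ, 0 < T ∧ 0 < δ ∧ δ < 1 ∧ 0 ≤ C ∧ WeakObservabilityInequality S B T C δ] := by
  tfae_have 1 → 2 := fun h => ⟨1, one_pos, h 1 one_pos⟩
  tfae_have 2 → 3 := fun ⟨T, hT, h⟩ => exists_weakObservabilityInequality S B hT h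
  tfae_have 3 → 1 := fun ⟨T₀, δ, C, hT₀, hδ0, hδ, hC, h⟩ T hT =>
    isDPStabilizable_of_weakObservabilityInequality S B hT₀ hδ0 hδ hC h hT
  tfae_finish
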